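/- Notation. For $S\subseteq[d]$, $b\in\{0,1\}$ let $f_{S,b}(x)=b+\sum_{i\in S}x_i \pmod 2$ on $\{0,1\}^d$; $\mathsf{AffParity}_d=\{f_{S,b}\}$, $\mathsf{Parity}_d=\{f_{S,0}\}$. For a distribution $\mathcal D$ on $\{0,1\}^d$ and a target $f$, let $\mathcal D_f$ be the law of $(x,f(x))$, $x\sim\mathcal D$. A learner $A$ maps a sample and a random string $r$ to a hypothesis; its $n$-sample disagreement probability at $f$ is $\Pr[A(S,r)\ne A(S',r)]$ for independent $S,S'\sim\mathcal D_f^n$ and a shared $r$, and $A$ is $n$-sample $\rho$-replicable for a class under $\mathcal D$ if this is at most $\rho$ for every target $f$ of the class. $A$ is an $(\alpha,\beta)$-PAC learner of the class under $\mathcal D$ if for every target $f$ of the class, with probability at least $1-\beta$ over $S\sim\mathcal D_f^n$ and $r$, its output $h$ has $\Pr_{x\sim\mathcal D}[h(x)\neq f(x)]\le\alpha$. $\mathcal D$ is monotone if $\mathcal D(x)\ge\mathcal D(y)$ whenever $x\ge y$ coordinatewise. Theorem. There are a polynomial $N$ in four variables, a constant $c>0$, a Turing machine $M$ and polynomials $T,\kappa$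 such that for every $d\ge1$ and $\alpha,\beta,\rho\in(0,1)$ one can choose a number $n=n(d,\alpha,\beta,\rho)\le N(d,1/\alpha,1/\rho,\log(1/\beta))$ and a monotone product distribution $\mathcal D=\mathcal D_{d,\alpha,\beta,\rho}$ on $\{0,1\}^d$ with the following properties. (a) $n$-sample Gaussian elimination over $\mathbb F_2$ is not replicable for $\mathsf{AffParity}_d$ under $\mathcal D$ with constant probability. Here Gaussian elimination solves the system $\sum_i w_ix_i+b=y$, one equation for each example $(x,y)$, in the unknowns $(w,b)$, by elimination and back substitution, and a tie-breaking rule gives values to the free unknowns. For every tie-breaking rule, which may depend on the sample and on a random string of any distribution, there is a target in $\mathsf{AffParity}_d$ with disagreement probability at least $c$; and if the free unknowns are set by uniformly random bits, then the disagreement probability is at least $c$ for every target in $\mathsf{AffParity}_d$. (b) There is an $n$-sample learner for $\mathsf{AffParity}_d$ that uses $\kappa(n)$ uniformly random bits, outputs an affine parity $f_{S,b}$ (as the pair $(S,b)$), is $\rho$-replicable for $\mathsf{AffParity}_d$ under $\mathcal D$, is an $(\alpha,\beta)$-PAC learner of $\mathsf{AffParity}_d$ under $\mathcal D$, and is computed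 by $M$, from the sample and the random bits, in at most $T(n)$ steps. (c) Learning parities under $\mathcal D$ is SQ-hard: for all sequences $\alpha_d,\beta_d,\rho_d\in(0,1)$, every constant $\varepsilon\in(0,1/2)$ and all $a,m\in\mathbb N$, for all sufficiently large $d$ there is no statistical query algorithm (adaptive, possibly randomized, computationally unbounded) that makes at most $d^m$ queries $\phi:\{0,1\}^d\times\{0,1\}\to[-1,1]$, each answered by an oracle within some tolerance $\tau\ge d^{-a}$ of $\mathbb E_{x\sim\mathcal D}[\phi(x,f(x))]$, where $\mathcal D=\mathcal D_{d,\alpha_d,\beta_d,\rho_d}$, and that for every target $f\in\mathsf{Parity}_d$ and every such oracle outputs, with probability at least $2/3$, a hypothesis $h$ with $\Pr_{x\sim\mathcal D}[h(x)\ne f(x)]\le\varepsilon$. -/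

import Mathlib

open MeasureTheory ProbabilityTheory Filter

/-! ### The Boolean cube, affine parities and product distributions -/

/-- The Boolean cube `{0,1}^d`. With `false ≤ true` it carries the coordinatewise order. -/
abbrev Cube (d : ℕ) : Type := Fin d → Bool

/-- A bit as an element of the field with two elements. -/
def bit (b : Bool) : ZMod 2 := if b then 1 else 0

/-- A labelled example `(x, y)`; labels are bits, regarded as elements of the two-element field. -/
abbrev Example (d : ℕ) : Type := Cube d × ZMod 2

/-- The affine parity `f_{S,b}(x) = b + ∑_{i ∈ S} x_i`, computed modulo 2. -/
def affParity {d : ℕ} (S : Finset (Fin d)) (b : ZMod 2) (x : Cube d) : ZMod 2 :=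
  b + ∑ i ∈ S, bit (x i)

/-- The class `AffParity` of affine parities over `{0,1}^d`. -/
def affParityClass (d : ℕ) : Set (Cube d → ZMod 2) := {f | ∃ S b, f = affParity S b}

/-- The class `Parity` of parities over `{0,1}^d` (bias `b = 0`). -/
def parityClass (d : ℕ) : Set (Cube d → ZMod 2) := {f | ∃ S, f = affParity S 0}

/-- The product distribution on `{0,1}^d` whose `i`-th coordinate is `1` with probability `p i`. -/
noncomputable def prodDist {d : ℕ} (p : Fin d → unitInterval) : Measure (Cube d) :=
  Measure.pi fun i => bernoulliMeasure true false (p i)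

/-- A distribution on the cube is monotone if its probability mass function is monotone. -/
def IsMonotoneDist {d : ℕ} (D : Measure (Cube d)) : Prop :=
  ∀ x y : Cube d, y ≤ x → D {y} ≤ D {x}

/-- The distribution of a labelled example `(x, f x)` with `x ∼ D`. -/
noncomputable def labelled {d : ℕ} (D : Measure (Cube d)) (f : Cube d → ZMod 2) :
    Measure (Example d) :=
  D.map fun x => (x, f x)

/-! ### Replicability and PAC learning -/

/-- The law of `n` i.i.d. samples from `P`. -/
noncomputable def iidLaw {Z : Type} [MeasurableSpace Z] (P : Measure Z) (n : ℕ) :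
    Measure (Fin n → Z) :=
  Measure.pi fun _ => P

/-- The uniform distribution on random strings of `k` bits. -/
noncomputable def uniformBits (k : ℕ) : Measure (Fin k → Bool) :=
  (PMF.uniformOfFintype (Fin k → Bool)).toMeasure

/-- `Pr_{S, S' ∼ P^n, r ∼ R} [A(S, r) ≠ A(S', r)]`: the probability that two runs of `A` on
independent data sets, with shared random string, differ. -/
noncomputable def disagreement {Z H : Type} [MeasurableSpace Z] {n k : ℕ} (P : Measure Z)
    (R : Measure (Fin k → Bool)) (A : (Fin n → Z) → (Fin k → Bool) → H) : ℝ :=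
  ((iidLaw P n).prod ((iidLaw P n).prod R)).real {t | A t.1 t.2.2 ≠ A t.2.1 t.2.2}

/-- `A` is `n`-sample `ρ`-replicable under `P`, with random strings drawn from `R`. -/
def IsReplicable {Z H : Type} [MeasurableSpace Z] {n k : ℕ} (P : Measure Z)
    (R : Measure (Fin k → Bool)) (A : (Fin n → Z) → (Fin k → Bool) → H) (ρ : ℝ) : Prop :=
  disagreement P R A ≤ ρ

/-- The classification error of the hypothesis `h` for the target `f` under `D`. -/
noncomputable def classError {d : ℕ} (D : Measure (Cube d)) (h f : Cube d → ZMod 2) : ℝ :=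
  D.real {x | h x ≠ f x}

/-- Realizable `(α, β)`-PAC learning of the class `C` with marginal distribution `D`: for every
target, with probability at least `1 - β` over `n` labelled examples and the random string, the
output has error at most `α`. -/
def IsPACLearner {d n k : ℕ} (C : Set (Cube d → ZMod 2)) (D : Measure (Cube d))
    (R : Measure (Fin k → Bool))
    (A : (Fin n → Example d) → (Fin k → Bool) → (Cube d → ZMod 2)) (α β : ℝ) : Prop :=
  ∀ f ∈ C, 1 - β ≤ ((iidLaw (labelled D f) n).prod R).real {t | classError D (A t.1 t.2) f ≤ α}

/-! ### Gaussian elimination over the field with two elements -/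

/-- A linear equation `∑ j, r.1 j * v j = r.2` in `m` unknowns. -/
abbrev Equation (m : ℕ) : Type := (Fin m → ZMod 2) × ZMod 2

/-- Eliminate the unknown `j` from the equation `r` by means of the pivot equation `p`. -/
def clearWith {m : ℕ} (j : Fin m) (p r : Equation m) : Equation m :=
  if r.1 j = 0 then r else r - p

/-- Forward elimination along the listed unknowns. For each unknown the first equation that contains
it becomes its pivot equation, and the unknown is eliminated from all equations (the pivot equation
itself becomes `0 = 0`); if no equation contains it, the unknown is free. The result
is the list of the pivot unknowns with their pivot equations. -/
def forwardElim {m : ℕ} : List (Fin m) → List (Equation m) → List (Fin m × Equation m)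
  | [], _ => []
  | j :: js, rows =>
    match rows.find? (fun r => decide (r.1 j ≠ 0)) with
    | none => forwardElim js rows
    | some p => (j, p) :: forwardElim js (rows.map (clearWith j p))

/-- Back substitution: the free unknowns take their values from `free`, and the pivot equations are
solved for their pivot unknowns, the last one first. -/
def backSubst {m : ℕ} (free : Fin m → ZMod 2) : List (Fin m × Equation m) → (Fin m → ZMod 2)
  | [] => free
  | (j, p) :: ps =>
    let v := backSubst free ps
    Function.update v j (p.2 - ∑ k ∈ Finset.univ.erase j, p.1 k * v k)

/-- Gaussian elimination, with the values `free` for the free unknowns. -/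
def gaussSolve {m : ℕ} (free : Fin m → ZMod 2) (rows : List (Equation m)) : Fin m → ZMod 2 :=
  backSubst free (forwardElim (List.finRange m) rows)

/-- The linear equation `∑ i, w i * x i + b = y` that the example `(x, y)` imposes on the unknown
coefficients `(w, b)`; the bias `b` is the last unknown. -/
def exampleEquation {d : ℕ} (e : Example d) : Equation (d + 1) :=
  (Fin.snoc (α := fun _ => ZMod 2) (fun i => bit (e.1 i)) 1, e.2)

/-- The affine parity with coefficients `v = (w, b)`. -/
def ofCoeffs {d : ℕ} (v : Fin (d + 1) → ZMod 2) : Cube d → ZMod 2 :=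
  affParity (Finset.univ.filter fun i : Fin d => v i.castSucc = 1) (v (Fin.last d))

/-- The `n`-sample Gaussian elimination learner for affine parities. It solves the linear system
given by the sample; the free unknowns are set by the tie-breaking rule `tie`, which may depend on
the sample and on the random string. -/
def gaussLearner {d n k : ℕ}
    (tie : (Fin n → Example d) → (Fin k → Bool) → (Fin (d + 1) → ZMod 2))
    (s : Fin n → Example d) (r : Fin k → Bool) : Cube d → ZMod 2 :=
  ofCoeffs (gaussSolve (tie s r) (List.ofFn fun i => exampleEquation (s i)))

/-! ### Learners computed by Turing machines -/

/-- The input string of a learner: for each example the bits of `x` and the label `y`, followed by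
the separator `none`; after the last example another `none` and then the random bits. -/
def encodeInput {d n k : ℕ} (s : Fin n → Example d) (r : Fin k → Bool) : List (Option (ZMod 2)) :=
  ((List.ofFn s).flatMap fun e => (List.ofFn fun i => some (bit (e.1 i))) ++ [some e.2, none]) ++
    none :: (List.ofFn fun j => some (bit (r j)))

/-- The output string for the affine parity `f_{S,b}`: the indicator bits of `S`, then `b`. -/
def encodeParity {d : ℕ} (h : Finset (Fin d) × ZMod 2) : List (ZMod 2) :=
  (List.ofFn fun i => if i ∈ h.1 then 1 else 0) ++ [h.2]

/-- The Turing machine `M` computes the learner `A`, which outputs a pair `(S, b)`, in at most `t`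
steps on every sample and every random string. -/
def ComputesInTime (M : Turing.TM2ComputableAux (Option (ZMod 2)) (ZMod 2)) {d n k : ℕ}
    (A : (Fin n → Example d) → (Fin k → Bool) → Finset (Fin d) × ZMod 2) (t : ℕ) : Prop :=
  ∀ s r, Nonempty (Turing.TM2OutputsInTime M.tm
    ((encodeInput s r).map M.inputAlphabet.invFun)
    (some ((encodeParity (A s r)).map M.outputAlphabet.invFun)) t)

/-! ### Statistical queries -/

/-- A statistical query: a function of labelled examples with values in `[-1, 1]`. -/
abbrev SQuery (d : ℕ) : Type := {φ : Example d → ℝ // ∀ e, |φ e| ≤ 1}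

/-- An SQ algorithm without computational restrictions: the next query and the final hypothesis
depend on the list of the answers received so far. -/
structure SQAlgorithm (d : ℕ) where
  /-- the next query -/
  query : List ℝ → SQuery d
  /-- the final hypothesis -/
  output : List ℝ → (Cube d → ZMod 2)

/-- The answers to the first queries of `A`, when the oracle answers the query `φ` by `O φ`. -/
def SQAlgorithm.answers {d : ℕ} (A : SQAlgorithm d) (O : SQuery d → ℝ) : ℕ → List ℝ
  | 0 => []
  | j + 1 => A.answers O j ++ [O (A.query (A.answers O j))]

/-- The hypothesis of `A` after `q` queries to the oracle `O`. -/
def SQAlgorithm.hypothesis {d : ℕ} (A : SQAlgorithm d) (O : SQuery d → ℝ) (q : ℕ) :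
    Cube d → ZMod 2 :=
  A.output (A.answers O q)

/-- `O` is an SQ oracle of tolerance `τ` for the target `c` under `D`. -/
def IsSQOracle {d : ℕ} (D : Measure (Cube d)) (c : Cube d → ZMod 2) (τ : ℝ)
    (O : SQuery d → ℝ) : Prop :=
  ∀ φ : SQuery d, |O φ - ∫ e, φ.1 e ∂(labelled D c)| ≤ τ

/-- Some SQ algorithm, possibly randomized (a random choice `A ω` of deterministic ones), learns
the class `C` under `D` up to error `ε` from `q` queries of tolerance `τ`: for every target and every
SQ oracle for it, the hypothesis has error at most `ε` with probability at least `2/3`. -/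
def SQLearnable {d : ℕ} (C : Set (Cube d → ZMod 2)) (D : Measure (Cube d)) (q : ℕ) (τ ε : ℝ) :
    Prop :=
  ∃ (Ω : Type) (_ : MeasurableSpace Ω) (μ : Measure Ω) (_ : IsProbabilityMeasure μ)
    (A : Ω → SQAlgorithm d),
    ∀ c ∈ C, ∀ O : SQuery d → ℝ, IsSQOracle D c τ O →
      ∃ E : Set Ω, MeasurableSet E ∧ 2 / 3 ≤ μ.real E ∧
        ∀ ω ∈ E, classError D ((A ω).hypothesis O q) c ≤ ε

/-- SQ hardness of the classes `C d` under the distributions `D d`, `d = 0, 1, 2, …`: for every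
constant accuracy `ε < 1/2`, learning up to error `ε` from queries whose tolerance is at least an
inverse polynomial in `d` requires more than polynomially many queries. -/
def SQHard (C : ∀ d : ℕ, Set (Cube d → ZMod 2)) (D : ∀ d : ℕ, Measure (Cube d)) : Prop :=
  ∀ ε : ℝ, 0 < ε → ε < 1 / 2 → ∀ a m : ℕ, ∀ᶠ d : ℕ in atTop,
    ∀ (q : ℕ) (τ : ℝ), q ≤ d ^ m → 1 / (d : ℝ) ^ a ≤ τ → ¬ SQLearnable (C d) (D d) q τ ε

/-! Let the first bit `x₀` be `1` with probability `1 - 1/n`, where `n` is the sample size itself,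
and let all other bits be fair. No bit favours `0`, so this distribution is monotone. All `n`
examples have `x₀ = 1` with probability between `1/9` and `1/2`.

Gaussian elimination: if the examples with `x₀ = 1` span the space (`Determines`) and some example
has `x₀ = 0`, only the target is consistent with the sample, whatever the tie-breaking
(`gaussLearner_eq`); this has probability at least `3/8` (`le_real_unique`). If `x₀ = 1` throughout,
the targets `0` and `1 + x₀` give the same labelled sample, so the output is wrong for one of them.
An independent pair of one good and one bad run yields constant disagreement. With random ties the
bias is a free unknown on such samples (`gaussLearner_zero`), hence a coin toss for every target.

Replicable learner: discard the rare examples with `x₀ = 0` and solve for a linear form without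
bias. On spanning samples the unique solution is the target with its bias moved into the coefficient
of `x₀` (`elimBits_eq`). It depends on the target only and errs at most where `x₀ = 0`, a set of
mass `1/n ≤ α`. A union bound over nonzero forms (`real_not_determines_le`) makes spanning likely
enough for `ρ` and `β`. The elimination is an explicit stack machine that makes one pass over the
rows per unknown (`runsIn_elim`); its algebraic correctness is `elimIter_solution`.

SQ hardness: the signs of parities of fair bits are orthonormal. By Bessel's inequality a query
distinguishes few of them from random labels, so an oracle may answer most queries without revealing
the target (`card_le_of_sqLearnable`). -/

/-! ### Gauss–Jordan elimination on lists of rows -/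

/-- A row of an augmented matrix over the field with two elements. -/
abbrev Row : Type := List (ZMod 2)

/-- The entry `s + c * t` of a row to which `c` times the pivot row is added. In restricting mode
(`i = true`), rows with `c = 0` are replaced by zero. -/
def mixBit (i : Bool) (c s t : ZMod 2) : ZMod 2 := if i = true ∧ c = 0 then 0 else s + c * t

/-- Add `c` times the pivot row to a row; the pivot row is padded by zeros. -/
def addRow (i : Bool) (c : ZMod 2) : Row → Row → Row
  | [], _ => []
  | s :: r, p => mixBit i c s (p.headD 0) :: addRow i c r p.tail

/-- Eliminate the leading unknown by means of a pivot row, and drop its column. -/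
def elimRow (i : Bool) (p : Row) : Row → Row
  | [] => []
  | c :: r => addRow i c r p

/-- One pass of the elimination. The first nonempty row before the first empty row that starts with
`1` is the pivot row; it is moved to the end. -/
def elimPass (i : Bool) : Bool → Row → List Row → List Row
  | _, p, [] => [p]
  | _, p, [] :: L => [] :: elimPass i true p L
  | f, p, (c :: r) :: L =>
    if c = 1 ∧ f = false then elimPass i true r L else addRow i c r p :: elimPass i f p L

/-- Repeated passes; only the first one may be in restricting mode. -/
def elimIter : ℕ → Bool → List Row → List Row
  | 0, _, L => L
  | k + 1, i, L => elimIter k false (elimPass i false [] L)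

/-- The leading bits of the rows after the first empty row. -/
def leadBits : Bool → List Row → Row
  | _, [] => []
  | false, [] :: L => leadBits true L
  | true, [] :: L => 0 :: leadBits true L
  | false, (_ :: _) :: L => leadBits false L
  | true, (w :: _) :: L => w :: leadBits true L

/-- Rows as a string, each row followed by a separator. -/
def encodeRows (L : List Row) : List (Option (ZMod 2)) := L.flatMap fun r => r.map some ++ [none]

@[simp] lemma encodeRows_nil : encodeRows [] = [] := rfl

@[simp] lemma encodeRows_cons (r : Row) (L : List Row) :
    encodeRows (r :: L) = r.map some ++ none :: encodeRows L := by
  simp [encodeRows]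

lemma addRow_length (i : Bool) (c : ZMod 2) (r p : Row) : (addRow i c r p).length = r.length := by
  induction r generalizing p with
  | nil => rfl
  | cons s r ih => simp [addRow, ih]

lemma leadBits_length_le (f : Bool) (L : List Row) :
    (leadBits f L).length ≤ (encodeRows L).length := by
  induction L generalizing f with
  | nil => cases f <;> simp [leadBits]
  | cons r L ih =>
    have h1 := ih true
    have h2 := ih false
    cases f <;> cases r <;> simp [leadBits] <;> omega

/-! ### A stack machine for the elimination -/

/-- The stacks of the elimination machine. -/
inductive Stack
  | main | aux | pivot | temp | count | out
  deriving DecidableEq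

instance : Fintype Stack :=
  ⟨{.main, .aux, .pivot, .temp, .count, .out}, by intro k; cases k <;> decide⟩

/-- The alphabets of the stacks. -/
abbrev StackAlphabet : Stack → Type
  | .main => Option (ZMod 2)
  | .aux => Option (ZMod 2)
  | .pivot => ZMod 2
  | .temp => ZMod 2
  | .count => ZMod 2
  | .out => ZMod 2

/-- The labels of the elimination machine. -/
inductive Label
  | countCols | back | loop | lead | zip | pivot | restore | append | collect | skip | emit
  deriving DecidableEq

instance : Fintype Label :=
  ⟨{.countCols, .back, .loop, .lead, .zip, .pivot, .restore, .append, .collect, .skip, .emit},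
    by intro l; cases l <;> decide⟩

/-- The internal states of the elimination machine. -/
structure MState where
  /-- restricting mode -/
  restrict : Bool
  /-- a pivot row or the first empty row was seen -/
  seen : Bool
  /-- the leading bit of the current row -/
  lead : ZMod 2
  /-- the last symbol read from `main` or `aux` -/
  sym : Option (Option (ZMod 2))
  /-- the last bit read from another stack -/
  bit : Option (ZMod 2)
  deriving Fintype

namespace MState

/-- The state without symbols in the registers. -/
def idle (i f : Bool) (c : ZMod 2) : MState := ⟨i, f, c, none, none⟩

/-- Clear the registers. -/
def clear (v : MState) : MState := idle v.restrict v.seen v.lead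

/-- The bit in the symbol register. -/
def symBit (v : MState) : ZMod 2 := (v.sym.getD none).getD 0

/-- The symbol register holds a bit. -/
def hasBit (v : MState) : Bool := (v.sym.getD none).isSome

end MState

open Turing.TM2.Stmt in
/-- The program of the elimination machine. -/
def elimProgram : Label → Turing.TM2.Stmt StackAlphabet Label MState
  | .countCols =>
    pop .main (fun v a => { v with sym := a }) <|
    branch MState.hasBit
      (push .aux (fun v => some v.symBit) <| push .count (fun _ => 0) <|
        load MState.clear <| goto fun _ => .countCols)
      (push .aux (fun _ => none) <| pop .count (fun v _ => v) <|
        load MState.clear <| goto fun _ => .back)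
  | .back =>
    pop .aux (fun v a => { v with sym := a }) <|
    branch (fun v => v.sym.isSome)
      (push .main (fun v => v.sym.getD none) <| load MState.clear <| goto fun _ => .back)
      (load MState.clear <| goto fun _ => .loop)
  | .loop =>
    pop .count (fun v a => { v with bit := a }) <|
    branch (fun v => v.bit.isSome)
      (load MState.clear <| goto fun _ => .lead)
      (load MState.clear <| goto fun _ => .collect)
  | .lead =>
    pop .main (fun v a => { v with sym := a }) <|
    branch MState.hasBit
      (branch (fun v => decide (v.symBit = 1 ∧ v.seen = false))
        (load (fun v => .idle v.restrict true 0) <| goto fun _ => .pivot)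
        (load (fun v => .idle v.restrict v.seen v.symBit) <| goto fun _ => .zip))
      (branch (fun v => v.sym.isSome)
        (push .aux (fun _ => none) <| load (fun v => .idle v.restrict true 0) <|
          goto fun _ => .lead)
        (load MState.clear <| goto fun _ => .append))
  | .zip =>
    pop .main (fun v a => { v with sym := a }) <|
    branch MState.hasBit
      (pop .pivot (fun v a => { v with bit := a }) <|
        push .aux (fun v => some (mixBit v.restrict v.lead v.symBit (v.bit.getD 0))) <|
        branch (fun v => v.bit.isSome)
          (push .temp (fun v => v.bit.getD 0) <| load MState.clear <| goto fun _ => .zip)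
          (load MState.clear <| goto fun _ => .zip))
      (push .aux (fun _ => none) <| load (fun v => .idle v.restrict v.seen 0) <|
        goto fun _ => .restore)
  | .pivot =>
    pop .main (fun v a => { v with sym := a }) <|
    branch MState.hasBit
      (push .temp (fun v => v.symBit) <| load MState.clear <| goto fun _ => .pivot)
      (load MState.clear <| goto fun _ => .restore)
  | .restore =>
    pop .temp (fun v a => { v with bit := a }) <|
    branch (fun v => v.bit.isSome)
      (push .pivot (fun v => v.bit.getD 0) <| load MState.clear <| goto fun _ => .restore)
      (load MState.clear <| goto fun _ => .lead)
  | .append =>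
    pop .pivot (fun v a => { v with bit := a }) <|
    branch (fun v => v.bit.isSome)
      (push .aux (fun v => some (v.bit.getD 0)) <| load MState.clear <| goto fun _ => .append)
      (push .aux (fun _ => none) <| load (fun _ => .idle false false 0) <| goto fun _ => .back)
  | .collect =>
    pop .main (fun v a => { v with sym := a }) <|
    branch (fun v => v.sym.isSome)
      (branch MState.hasBit
        (branch (fun v => v.seen)
          (push .temp (fun v => v.symBit) <| load MState.clear <| goto fun _ => .skip)
          (load MState.clear <| goto fun _ => .skip))
        (branch (fun v => v.seen)
          (push .temp (fun _ => 0) <| load MState.clear <| goto fun _ => .collect)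
          (load (fun v => .idle v.restrict true 0) <| goto fun _ => .collect)))
      (push .out (fun _ => 0) <| load MState.clear <| goto fun _ => .emit)
  | .skip =>
    pop .main (fun v a => { v with sym := a }) <|
    branch MState.hasBit
      (load MState.clear <| goto fun _ => .skip)
      (load MState.clear <| goto fun _ => .collect)
  | .emit =>
    pop .temp (fun v a => { v with bit := a }) <|
    branch (fun v => v.bit.isSome)
      (push .out (fun v => v.bit.getD 0) <| load MState.clear <| goto fun _ => .emit)
      (load (fun _ => .idle true false 0) <| halt)

/-- The elimination machine. -/
def elimMachine : Turing.FinTM2 where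
  K := Stack
  k₀ := .main
  k₁ := .out
  Γ := StackAlphabet
  Λ := Label
  main := .countCols
  σ := MState
  initialState := .idle true false 0
  Γk₀Fin := inferInstanceAs (Fintype (Option (ZMod 2)))
  m := elimProgram

/-- The elimination machine with its alphabets. -/
def elimComputer : Turing.TM2ComputableAux (Option (ZMod 2)) (ZMod 2) where
  tm := elimMachine
  inputAlphabet := Equiv.refl _
  outputAlphabet := Equiv.refl _

/-- Stack contents. -/
def tapes (x b : List (Option (ZMod 2))) (p q c o : List (ZMod 2)) :
    ∀ k, List (StackAlphabet k)
  | .main => x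
  | .aux => b
  | .pivot => p
  | .temp => q
  | .count => c
  | .out => o

section Update

variable (x b x' : List (Option (ZMod 2))) (p q c o p' : List (ZMod 2))

@[simp] lemma tapes_main : tapes x b p q c o .main = x := rfl
@[simp] lemma tapes_aux : tapes x b p q c o .aux = b := rfl
@[simp] lemma tapes_pivot : tapes x b p q c o .pivot = p := rfl
@[simp] lemma tapes_temp : tapes x b p q c o .temp = q := rfl
@[simp] lemma tapes_count : tapes x b p q c o .count = c := rfl
@[simp] lemma tapes_out : tapes x b p q c o .out = o := rfl

@[simp] lemma update_tapes_main :
    Function.update (tapes x b p q c o) .main x' = tapes x' b p q c o := by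
  funext k; cases k <;> rfl
@[simp] lemma update_tapes_aux :
    Function.update (tapes x b p q c o) .aux x' = tapes x x' p q c o := by
  funext k; cases k <;> rfl
@[simp] lemma update_tapes_pivot :
    Function.update (tapes x b p q c o) .pivot p' = tapes x b p' q c o := by
  funext k; cases k <;> rfl
@[simp] lemma update_tapes_temp :
    Function.update (tapes x b p q c o) .temp p' = tapes x b p p' c o := by
  funext k; cases k <;> rfl
@[simp] lemma update_tapes_count :
    Function.update (tapes x b p q c o) .count p' = tapes x b p q p' o := by
  funext k; cases k <;> rfl
@[simp] lemma update_tapes_out :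
    Function.update (tapes x b p q c o) .out p' = tapes x b p q c p' := by
  funext k; cases k <;> rfl

end Update

/-- A configuration of the elimination machine. -/
abbrev ECfg : Type := Turing.TM2.Cfg StackAlphabet Label MState

/-- The machine gets from one configuration to another in at most `t` steps. -/
def RunsIn (t : ℕ) (a b : ECfg) : Prop :=
  ∃ s ≤ t, (flip Bind.bind (Turing.TM2.step elimProgram))^[s] (some a) = some b

lemma RunsIn.refl (a : ECfg) : RunsIn 0 a a := ⟨0, le_rfl, rfl⟩

lemma RunsIn.trans {t t' : ℕ} {a b c : ECfg} (h : RunsIn t a b) (h' : RunsIn t' b c) :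
    RunsIn (t + t') a c := by
  obtain ⟨s, hs, h⟩ := h
  obtain ⟨s', hs', h'⟩ := h'
  exact ⟨s' + s, by omega, by rw [Function.iterate_add_apply, h, h']⟩

lemma RunsIn.mono {t t' : ℕ} {a b : ECfg} (h : RunsIn t a b) (ht : t ≤ t') : RunsIn t' a b := by
  obtain ⟨s, hs, h⟩ := h
  exact ⟨s, hs.trans ht, h⟩

lemma RunsIn.step {l : Label} {v : MState} {S : ∀ k, List (StackAlphabet k)} {b : ECfg}
    (h : Turing.TM2.stepAux (elimProgram l) v S = b) : RunsIn 1 ⟨some l, v, S⟩ b :=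
  ⟨1, le_rfl, by subst h; rfl⟩

section Runs

variable (x b : List (Option (ZMod 2))) (p q ct o : List (ZMod 2)) (i f : Bool) (c : ZMod 2)

/-- The counter receives one symbol per entry of the first row and loses one for the label column,
which leaves one pass per unknown. -/
lemma runsIn_countCols (r : Row) :
    RunsIn (r.length + 1)
      ⟨some .countCols, .idle i f c, tapes (r.map some ++ none :: x) b p q ct o⟩
      ⟨some .back, .idle i f c, tapes x (none :: ((r.map some).reverse ++ b)) p q
        (List.replicate r.length 0 ++ ct).tail o⟩ := by
  induction r generalizing b ct with
  | nil => exact RunsIn.step (by simp [elimProgram, MState.hasBit, MState.clear, MState.idle])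
  | cons s r ih =>
    have h := (RunsIn.step (l := .countCols) (v := .idle i f c)
      (S := tapes ((s :: r).map some ++ none :: x) b p q ct o) (by
        simp [elimProgram, MState.hasBit, MState.clear, MState.idle, MState.symBit])).trans
      (ih (some s :: b) (0 :: ct))
    refine RunsIn.mono ?_ (Nat.add_comm _ _).le
    simpa [List.replicate_succ', MState.idle] using h

lemma runsIn_back :
    RunsIn (b.length + 1) ⟨some .back, .idle i f c, tapes x b p q ct o⟩
      ⟨some .loop, .idle i f c, tapes (b.reverse ++ x) [] p q ct o⟩ := by
  induction b generalizing x with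
  | nil => exact RunsIn.step (by simp [elimProgram, MState.clear, MState.idle])
  | cons s b ih =>
    have h := (RunsIn.step (l := .back) (v := .idle i f c)
      (S := tapes x (s :: b) p q ct o) (by
        simp [elimProgram, MState.clear, MState.idle])).trans (ih (s :: x))
    refine RunsIn.mono ?_ (Nat.add_comm _ _).le
    simpa [MState.idle] using h

/-- Pivot entries that are read are parked in reverse order on `temp`; the `restore` phase puts them
back, so the pivot row survives for the next row. -/
lemma runsIn_zip (r : Row) :
    RunsIn (r.length + 1) ⟨some .zip, .idle i f c, tapes (r.map some ++ none :: x) b p q ct o⟩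
      ⟨some .restore, .idle i f 0, tapes x (none :: (((addRow i c r p).map some).reverse ++ b))
        (p.drop r.length) ((p.take r.length).reverse ++ q) ct o⟩ := by
  induction r generalizing b p q with
  | nil => exact RunsIn.step (by simp [elimProgram, MState.hasBit, MState.idle, addRow])
  | cons s r ih =>
    refine RunsIn.mono ?_ (Nat.add_comm _ _).le
    cases p with
    | nil =>
      have h := (RunsIn.step (l := .zip) (v := .idle i f c)
        (S := tapes ((s :: r).map some ++ none :: x) b [] q ct o) (by
          simp [elimProgram, MState.hasBit, MState.clear, MState.idle, MState.symBit])).trans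
        (ih (some (mixBit i c s 0) :: b) [] q)
      simpa [MState.idle, addRow] using h
    | cons t p =>
      have h := (RunsIn.step (l := .zip) (v := .idle i f c)
        (S := tapes ((s :: r).map some ++ none :: x) b (t :: p) q ct o) (by
          simp [elimProgram, MState.hasBit, MState.clear, MState.idle, MState.symBit])).trans
        (ih (some (mixBit i c s t) :: b) p (t :: q))
      simpa [MState.idle, addRow] using h

lemma runsIn_pivot (r : Row) :
    RunsIn (r.length + 1) ⟨some .pivot, .idle i f c, tapes (r.map some ++ none :: x) b p q ct o⟩
      ⟨some .restore, .idle i f c, tapes x b p (r.reverse ++ q) ct o⟩ := by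
  induction r generalizing q with
  | nil => exact RunsIn.step (by simp [elimProgram, MState.hasBit, MState.clear, MState.idle])
  | cons s r ih =>
    have h := (RunsIn.step (l := .pivot) (v := .idle i f c)
      (S := tapes ((s :: r).map some ++ none :: x) b p q ct o) (by
        simp [elimProgram, MState.hasBit, MState.clear, MState.idle, MState.symBit])).trans
      (ih (s :: q))
    refine RunsIn.mono ?_ (Nat.add_comm _ _).le
    simpa [MState.idle] using h

lemma runsIn_restore :
    RunsIn (q.length + 1) ⟨some .restore, .idle i f c, tapes x b p q ct o⟩
      ⟨some .lead, .idle i f c, tapes x b (q.reverse ++ p) [] ct o⟩ := by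
  induction q generalizing p with
  | nil => exact RunsIn.step (by simp [elimProgram, MState.clear, MState.idle])
  | cons s q ih =>
    have h := (RunsIn.step (l := .restore) (v := .idle i f c)
      (S := tapes x b p (s :: q) ct o) (by
        simp [elimProgram, MState.clear, MState.idle])).trans (ih (s :: p))
    refine RunsIn.mono ?_ (Nat.add_comm _ _).le
    simpa [MState.idle] using h

lemma runsIn_append :
    RunsIn (p.length + 1) ⟨some .append, .idle i f c, tapes x b p q ct o⟩
      ⟨some .back, .idle false false 0,
        tapes x (none :: ((p.map some).reverse ++ b)) [] q ct o⟩ := by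
  induction p generalizing b with
  | nil => exact RunsIn.step (by simp [elimProgram, MState.idle])
  | cons s p ih =>
    have h := (RunsIn.step (l := .append) (v := .idle i f c)
      (S := tapes x b (s :: p) q ct o) (by
        simp [elimProgram, MState.clear, MState.idle])).trans (ih (some s :: b))
    refine RunsIn.mono ?_ (Nat.add_comm _ _).le
    simpa [MState.idle] using h

lemma runsIn_emit :
    RunsIn (q.length + 1) ⟨some .emit, .idle i f c, tapes x b p q ct o⟩
      ⟨none, .idle true false 0, tapes x b p [] ct (q.reverse ++ o)⟩ := by
  induction q generalizing o with
  | nil => exact RunsIn.step (by simp [elimProgram, MState.idle])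
  | cons s q ih =>
    have h := (RunsIn.step (l := .emit) (v := .idle i f c)
      (S := tapes x b p (s :: q) ct o) (by
        simp [elimProgram, MState.clear, MState.idle])).trans (ih (s :: o))
    refine RunsIn.mono ?_ (Nat.add_comm _ _).le
    simpa [MState.idle] using h

lemma runsIn_skip (r : Row) :
    RunsIn (r.length + 1) ⟨some .skip, .idle i f c, tapes (r.map some ++ none :: x) b p q ct o⟩
      ⟨some .collect, .idle i f c, tapes x b p q ct o⟩ := by
  induction r with
  | nil => exact RunsIn.step (by simp [elimProgram, MState.hasBit, MState.clear, MState.idle])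
  | cons s r ih =>
    have h := (RunsIn.step (l := .skip) (v := .idle i f c)
      (S := tapes ((s :: r).map some ++ none :: x) b p q ct o) (by
        simp [elimProgram, MState.hasBit, MState.clear, MState.idle])).trans ih
    exact RunsIn.mono h (Nat.add_comm _ _).le

/-- The rows up to the end of a pass. -/
lemma runsIn_lead (L : List Row) (hp : f = false → p = []) :
    ∃ f' p' b', RunsIn (3 * (encodeRows L).length + 1)
      ⟨some .lead, .idle i f 0, tapes (encodeRows L) b p [] ct o⟩
      ⟨some .append, .idle i f' 0, tapes [] b' p' [] ct o⟩ ∧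
      none :: ((p'.map some).reverse ++ b') = (encodeRows (elimPass i f p L)).reverse ++ b := by
  induction L generalizing f p b with
  | nil =>
    refine ⟨f, p, b, RunsIn.mono (RunsIn.step ?_) (by simp), by simp [elimPass]⟩
    simp [elimProgram, MState.hasBit, MState.clear, MState.idle]
  | cons r L ih =>
    cases r with
    | nil =>
      -- The first empty row ends the search for a pivot: the rows behind it are pivot rows of
      -- earlier passes.
      obtain ⟨f', p', b', h, h'⟩ := ih (none :: b) p true (by simp)
      refine ⟨f', p', b', RunsIn.mono ((RunsIn.step ?_).trans h) (by simp; omega), ?_⟩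
      · simp [elimProgram, MState.hasBit, MState.idle]
      · simpa [elimPass] using h'
    | cons s r =>
      by_cases hs : s = 1 ∧ f = false
      · obtain ⟨rfl, rfl⟩ := hs
        obtain rfl := hp rfl
        obtain ⟨f', p', b', h, h'⟩ := ih b r true (by simp)
        refine ⟨f', p', b', RunsIn.mono ((RunsIn.step (b := ⟨some .pivot, .idle i true 0,
          tapes (r.map some ++ none :: encodeRows L) b [] [] ct o⟩) ?_).trans
          ((runsIn_pivot _ _ _ _ _ _ _ _ _ r).trans ((runsIn_restore ..).trans
          (?_ : RunsIn (3 * (encodeRows L).length + 1) _ _))))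
          ?_, ?_⟩
        · simp [elimProgram, MState.hasBit, MState.idle, MState.symBit]
        · simpa using h
        · simp; omega
        · simpa [elimPass] using h'
      · obtain ⟨f', p', b', h, h'⟩ :=
          ih (none :: (((addRow i s r p).map some).reverse ++ b)) p f hp
        refine ⟨f', p', b', RunsIn.mono ((RunsIn.step (b := ⟨some .zip, .idle i f s,
          tapes (r.map some ++ none :: encodeRows L) b p [] ct o⟩) ?_).trans
          ((runsIn_zip _ _ _ _ _ _ _ _ _ r).trans ((runsIn_restore ..).trans
          (?_ : RunsIn (3 * (encodeRows L).length + 1) _ _))))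
          ?_, ?_⟩
        · simp [elimProgram, MState.hasBit, MState.idle, MState.symBit]
          change cond (decide (s = 1 ∧ f = false)) _ _ = _
          rw [decide_eq_false hs, cond_false]
        · simpa using h
        · simp; omega
        · simpa [elimPass, hs] using h'

/-- Reading off the solution. -/
lemma runsIn_collect (L : List Row) :
    ∃ f', RunsIn (2 * (encodeRows L).length + 1)
      ⟨some .collect, .idle i f 0, tapes (encodeRows L) b p q ct o⟩
      ⟨some .emit, .idle i f' 0, tapes [] b p ((leadBits f L).reverse ++ q) ct (0 :: o)⟩ := by
  induction L generalizing f q with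
  | nil =>
    refine ⟨f, RunsIn.mono (RunsIn.step ?_) (by simp)⟩
    cases f <;> simp [elimProgram, MState.clear, MState.idle, leadBits]
  | cons r L ih =>
    cases r with
    | nil =>
      obtain ⟨f', h⟩ := ih (if f then 0 :: q else q) true
      refine ⟨f', RunsIn.mono ((RunsIn.step (b := ⟨some .collect, .idle i true 0,
        tapes (encodeRows L) b p (if f then 0 :: q else q) ct o⟩) ?_).trans
        (?_ : RunsIn (2 * (encodeRows L).length + 1) _ _)) ?_⟩
      · cases f <;> simp [elimProgram, MState.hasBit, MState.clear, MState.idle]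
      · cases f <;> simpa [leadBits] using h
      · simp; omega
    | cons s r =>
      obtain ⟨f', h⟩ := ih (if f then s :: q else q) f
      refine ⟨f', RunsIn.mono ((RunsIn.step (b := ⟨some .skip, .idle i f 0,
        tapes (r.map some ++ none :: encodeRows L) b p (if f then s :: q else q) ct o⟩) ?_).trans
        ((runsIn_skip _ _ _ _ _ _ _ _ _ r).trans
        (?_ : RunsIn (2 * (encodeRows L).length + 1) _ _))) ?_⟩
      · cases f <;> simp [elimProgram, MState.hasBit, MState.clear, MState.idle, MState.symBit]
      · cases f <;> simpa [leadBits] using h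
      · simp; omega

end Runs

/-- A pass shortens rows and moves the pivot row to the end; only the separator of the row appended
there can be new. Hence the tape grows by at most one symbol per pass, which keeps the total time
polynomial. -/
lemma encodeRows_elimPass_length_le (i f : Bool) (p : Row) (L : List Row)
    (hp : f = false → p = []) :
    (encodeRows (elimPass i f p L)).length ≤ (encodeRows L).length + p.length + 1 := by
  induction L generalizing f p with
  | nil => simp [elimPass]
  | cons r L ih =>
    cases r with
    | nil =>
      have := ih true p (by simp)
      simp [elimPass]
      omega
    | cons s r =>
      by_cases hs : s = 1 ∧ f = false
      · have := ih true r (by simp)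
        simp [elimPass, hs]
        omega
      · have := ih f p hp
        simp [elimPass, hs, addRow_length]
        omega

lemma runsIn_pass (L : List Row) (i : Bool) (ct : List (ZMod 2)) :
    RunsIn (5 * (encodeRows L).length + 6)
      ⟨some .loop, .idle i false 0, tapes (encodeRows L) [] [] [] (0 :: ct) []⟩
      ⟨some .loop, .idle false false 0,
        tapes (encodeRows (elimPass i false [] L)) [] [] [] ct []⟩ := by
  obtain ⟨f', p', b', h, h'⟩ := runsIn_lead [] [] ct [] i false L (by simp)
  have hl := encodeRows_elimPass_length_le i false [] L (by simp)
  have hl' := congrArg List.length h'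
  have hb := runsIn_back [] (none :: ((p'.map some).reverse ++ b')) [] [] ct [] false false 0
  refine RunsIn.mono ((RunsIn.step (b := ⟨some .lead, .idle i false 0,
    tapes (encodeRows L) [] [] [] ct []⟩) ?_).trans
    (h.trans ((runsIn_append ..).trans (?_ : RunsIn ((encodeRows L).length + 2) _ _)))) ?_
  · simp [elimProgram, MState.clear, MState.idle]
  · refine RunsIn.mono (t := (none :: ((p'.map some).reverse ++ b')).length + 1) ?_ ?_
    · simpa [h'] using hb
    · simp at hl' hl ⊢
      omega
  · simp at hl hl' ⊢
    omega

lemma runsIn_iter (k : ℕ) (L : List Row) (i : Bool) :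
    RunsIn (k * (5 * ((encodeRows L).length + k) + 6))
      ⟨some .loop, .idle i false 0, tapes (encodeRows L) [] [] [] (List.replicate k 0) []⟩
      ⟨some .loop, .idle (if k = 0 then i else false) false 0,
        tapes (encodeRows (elimIter k i L)) [] [] [] [] []⟩ := by
  induction k generalizing L i with
  | zero => simpa [elimIter] using RunsIn.refl _
  | succ k ih =>
    have h := (runsIn_pass L i (List.replicate k 0)).trans (ih (elimPass i false [] L) false)
    have hl := encodeRows_elimPass_length_le i false [] L (by simp)
    refine RunsIn.mono (t := _) (by simpa [elimIter, List.replicate_succ] using h) ?_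
    simp at hl
    nlinarith [Nat.mul_le_mul_left k hl]

lemma encodeRows_elimIter_length_le (k : ℕ) (i : Bool) (L : List Row) :
    (encodeRows (elimIter k i L)).length ≤ (encodeRows L).length + k := by
  induction k generalizing L i with
  | zero => simp [elimIter]
  | succ k ih =>
    have h1 := ih false (elimPass i false [] L)
    have h2 := encodeRows_elimPass_length_le i false [] L (by simp)
    simp [elimIter] at h1 h2 ⊢
    omega

/-- The machine on a nonempty list of rows. -/
lemma runsIn_elim (r : Row) (L : List Row) {d : ℕ} (hr : r.length = d + 1) :
    RunsIn ((d + 2) * (5 * ((encodeRows (r :: L)).length + d) + 6))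
      ⟨some .countCols, .idle true false 0, tapes (encodeRows (r :: L)) [] [] [] [] []⟩
      ⟨none, .idle true false 0,
        tapes [] [] [] [] [] (leadBits false (elimIter d true (r :: L)) ++ [0])⟩ := by
  have h1 := runsIn_countCols (encodeRows L) [] [] [] [] [] true false 0 r
  have h2 := runsIn_back (encodeRows L) (none :: ((r.map some).reverse ++ [])) [] []
    (List.replicate d 0) [] true false 0
  have h3 := runsIn_iter d (r :: L) true
  have h4 : RunsIn 1
      ⟨some .loop, .idle (if d = 0 then true else false) false 0,
        tapes (encodeRows (elimIter d true (r :: L))) [] [] [] [] []⟩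
      ⟨some .collect, .idle (if d = 0 then true else false) false 0,
        tapes (encodeRows (elimIter d true (r :: L))) [] [] [] [] []⟩ :=
    RunsIn.step (by simp [elimProgram, MState.clear, MState.idle])
  obtain ⟨f', h5⟩ := runsIn_collect [] [] [] [] [] (if d = 0 then true else false) false
    (elimIter d true (r :: L))
  have h6 := runsIn_emit [] [] []
    ((leadBits false (elimIter d true (r :: L))).reverse ++ []) [] [0]
    (if d = 0 then true else false) f' 0
  have hl := encodeRows_elimIter_length_le d true (r :: L)
  have hb := leadBits_length_le false (elimIter d true (r :: L))
  rw [hr] at h1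
  simp only [List.replicate_succ, List.append_nil, List.tail_cons] at h1 h2
  simp only [List.reverse_cons, List.reverse_reverse, List.append_assoc, List.singleton_append,
    List.append_nil] at h2 h6
  rw [encodeRows_cons] at h3 ⊢
  refine RunsIn.mono (h1.trans (h2.trans (h3.trans (h4.trans (h5.trans (by simpa using h6)))))) ?_
  simp at hl hb ⊢
  nlinarith

/-! ### The elimination learner -/

/-- The augmented row of an example. -/
def exampleRow {d : ℕ} (e : Example d) : Row := (List.ofFn fun i => bit (e.1 i)) ++ [e.2]

/-- The rows of a sample, followed by an empty row. -/
def sampleRows {d n : ℕ} (s : Fin n → Example d) : List Row :=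
  (List.ofFn fun i => exampleRow (s i)) ++ [[]]

/-- The coefficients found by the elimination. -/
def elimBits {d n : ℕ} (s : Fin n → Example d) : Row :=
  leadBits false (elimIter d true (sampleRows s))

/-- The learner that eliminates on the examples whose first bit is `1`; its hypotheses have
bias `0`. -/
def elimLearner {d n k : ℕ} (s : Fin n → Example d) (_ : Fin k → Bool) :
    Finset (Fin d) × ZMod 2 :=
  (Finset.univ.filter fun i => (elimBits s)[(i : ℕ)]? = some 1, 0)

lemma elimPass_true (i : Bool) (p : Row) (L : List Row) :
    elimPass i true p L = L.map (elimRow i p) ++ [p] := by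
  induction L with
  | nil => rfl
  | cons r L ih => cases r <;> simp [elimPass, elimRow, ih]

lemma mixBit_zero (i : Bool) (s t : ZMod 2) : mixBit i 0 s t = mixBit i 0 s 0 := by
  simp [mixBit]

/-- Rows before the pivot row are processed while the pivot is still empty. They start with `0`, so
the result is the same as with the true pivot. -/
lemma addRow_zero (i : Bool) (r p : Row) : addRow i 0 r p = addRow i 0 r [] := by
  induction r generalizing p with
  | nil => rfl
  | cons s r ih =>
    rw [addRow, addRow, mixBit_zero, ih]
    rfl

lemma elimRow_length (i : Bool) (p r : Row) : (elimRow i p r).length = r.length - 1 := by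
  cases r <;> simp [elimRow, addRow_length]

lemma zmod_two_eq_zero_of_ne_one {c : ZMod 2} (h : c ≠ 1) : c = 0 := by
  revert h; revert c; decide

/-- The form of the result of a pass: `p` is the pivot row, if there is one, and empty otherwise;
the active rows `act` are followed by an empty row and the pivot rows `fin` of earlier passes. -/
lemma elimPass_eq (i : Bool) (act fin : List Row) (hact : ∀ r ∈ act, r ≠ []) :
    ∃ (p : Row) (act' : List Row),
      elimPass i false [] (act ++ [] :: fin) =
        act'.map (elimRow i p) ++ [] :: (fin.map (elimRow i p) ++ [p]) ∧
      ((p = [] ∧ act' = act ∧ ∀ r ∈ act, r.head? ≠ some 1) ∨ act.Perm ((1 :: p) :: act')) := by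
  induction act with
  | nil => exact ⟨[], [], by simp [elimPass, elimPass_true], Or.inl (by simp)⟩
  | cons r act ih =>
    obtain ⟨c, r, rfl⟩ := List.exists_cons_of_ne_nil (hact r (by simp))
    by_cases hc : c = 1
    · subst hc
      exact ⟨r, act, by simp [elimPass, elimPass_true, elimRow], Or.inr (List.Perm.refl _)⟩
    · obtain ⟨p, act', h, h'⟩ := ih fun r hr => hact r (by simp [hr])
      refine ⟨p, (c :: r) :: act', ?_, ?_⟩
      · have hc0 := zmod_two_eq_zero_of_ne_one hc
        subst hc0
        simp [elimPass, elimRow, h, addRow_zero i r p]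
      · rcases h' with ⟨hp, ha, hl⟩ | h'
        · exact Or.inl ⟨hp, by rw [ha], by simpa [hc] using hl⟩
        · exact Or.inr ((h'.cons _).trans (List.Perm.swap _ _ _))

/-- This needs no assumption on solvability: a pass without a pivot still appends a row, namely the
empty one. -/
lemma elimIter_shape (k m : ℕ) (i : Bool) (act fin : List Row)
    (hact : ∀ r ∈ act, r.length = k + m + 1) :
    ∃ act' fin' : List Row, elimIter k i (act ++ [] :: fin) = act' ++ [] :: fin' ∧
      (∀ r ∈ act', r.length = m + 1) ∧ fin'.length = fin.length + k := by
  induction k generalizing i act fin with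
  | zero => exact ⟨act, fin, rfl, by simpa using hact, rfl⟩
  | succ k ih =>
    obtain ⟨p, act', h, h'⟩ := elimPass_eq i act fin fun r hr h0 => by
      have := hact r hr
      simp [h0] at this
    obtain ⟨act₂, fin₂, h2, h3, h4⟩ := ih false (act'.map (elimRow i p))
      (fin.map (elimRow i p) ++ [p]) (by
        intro r hr
        obtain ⟨r', hr', rfl⟩ := List.mem_map.1 hr
        have hmem : r' ∈ act := by
          rcases h' with ⟨-, rfl, -⟩ | h'
          · exact hr'
          · exact h'.symm.subset (by simp [hr'])
        rw [elimRow_length, hact r' hmem]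
        omega)
    refine ⟨act₂, fin₂, by rw [elimIter, h, h2], h3, ?_⟩
    simp at h4
    omega

lemma leadBits_true_length (L : List Row) : (leadBits true L).length = L.length := by
  induction L with
  | nil => rfl
  | cons r L ih => cases r <;> simp [leadBits, ih]

lemma leadBits_append (act fin : List Row) (hact : ∀ r ∈ act, r ≠ []) :
    leadBits false (act ++ [] :: fin) = leadBits true fin := by
  induction act with
  | nil => rfl
  | cons r act ih =>
    obtain ⟨c, r, rfl⟩ := List.exists_cons_of_ne_nil (hact r (by simp))
    simpa [leadBits] using ih fun r hr => hact r (by simp [hr])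

lemma exampleRow_length {d : ℕ} (e : Example d) : (exampleRow e).length = d + 1 := by
  simp [exampleRow]

/-- The machine must output a well-formed hypothesis on every sample, including those that determine
nothing. -/
lemma elimBits_length {d n : ℕ} (s : Fin n → Example d) : (elimBits s).length = d := by
  obtain ⟨act, fin, h, h1, h2⟩ := elimIter_shape d 0 true (List.ofFn fun i => exampleRow (s i)) []
    (by
      intro r hr
      obtain ⟨i, rfl⟩ := (List.mem_ofFn' _ _).1 hr
      simp [exampleRow_length])
  rw [elimBits, sampleRows, h, leadBits_append _ _ (by
    intro r hr h0
    simpa [h0] using h1 r hr), leadBits_true_length, h2]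
  simp

lemma encodeParity_elimLearner {d n k : ℕ} (s : Fin n → Example d) (r : Fin k → Bool) :
    encodeParity (elimLearner s r) = elimBits s ++ [0] := by
  have hl := elimBits_length s
  have key : (List.ofFn fun i : Fin d => if i ∈ (elimLearner s r).1 then (1 : ZMod 2) else 0) =
      elimBits s := by
    apply List.ext_getElem (by simp [hl])
    intro j h1 h2
    have hj : j < d := by simpa using h1
    rw [List.getElem_ofFn]
    simp only [elimLearner, Finset.mem_filter, Finset.mem_univ, true_and,
      List.getElem?_eq_getElem h2, Option.some.injEq]
    split_ifs with h
    · exact h.symm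
    · exact (zmod_two_eq_zero_of_ne_one h).symm
  rw [encodeParity, key]
  rfl

/-- The extra separator after the sample encodes the empty row that marks the end of the active
rows; without random bits nothing follows it. -/
lemma encodeInput_eq {d n k : ℕ} (hk : k = 0) (s : Fin n → Example d) (r : Fin k → Bool) :
    encodeInput s r = encodeRows (sampleRows s) := by
  subst hk
  simp [encodeInput, encodeRows, sampleRows, List.flatMap_append, exampleRow, List.ofFn_eq_map,
    List.flatMap_map, List.map_append, Function.comp_def]

lemma encodeRows_sampleRows_length {d n : ℕ} (s : Fin n → Example d) :
    (encodeRows (sampleRows s)).length = n * (d + 2) + 1 := by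
  simp [encodeRows, sampleRows, List.length_flatMap, Function.comp_def, exampleRow_length,
    List.ofFn_eq_map]

lemma computesInTime_elimLearner {d n k : ℕ} (hk : k = 0) (hn : 0 < n) :
    ComputesInTime elimComputer (elimLearner : (Fin n → Example d) → (Fin k → Bool) → _)
      ((d + 2) * (5 * (n * (d + 2) + 1 + d) + 6)) := by
  intro s r
  have hrow : sampleRows s = exampleRow (s ⟨0, hn⟩) :: (sampleRows s).tail := by
    obtain ⟨m, rfl⟩ := Nat.exists_eq_succ_of_ne_zero hn.ne'
    simp [sampleRows, List.ofFn_succ]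
  obtain ⟨t, ht, h⟩ := runsIn_elim _ (sampleRows s).tail (exampleRow_length (s ⟨0, hn⟩))
  rw [← hrow, encodeRows_sampleRows_length] at ht
  rw [← hrow] at h
  refine ⟨⟨⟨t, ?_⟩, ht⟩⟩
  have hin : Turing.initList elimComputer.tm
      ((encodeInput s r).map elimComputer.inputAlphabet.invFun) =
      (⟨some .countCols, .idle true false 0,
        tapes (encodeRows (sampleRows s)) [] [] [] [] []⟩ : ECfg) := by
    have : (encodeInput s r).map elimComputer.inputAlphabet.invFun =
        encodeRows (sampleRows s) := by
      rw [encodeInput_eq hk]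
      exact List.map_id _
    rw [this]
    refine congrArg (Turing.TM2.Cfg.mk (some Label.countCols) (MState.idle true false 0)) ?_
    funext j
    cases j <;> rfl
  -- The prescribed halting configuration has the initial internal state and empty stacks except for
  -- the output, which is why `emit` resets the state.
  have hout : Turing.haltList elimComputer.tm
      ((encodeParity (elimLearner s r)).map elimComputer.outputAlphabet.invFun) =
      (⟨none, .idle true false 0, tapes [] [] [] [] [] (elimBits s ++ [0])⟩ : ECfg) := by
    have : (encodeParity (elimLearner s r)).map elimComputer.outputAlphabet.invFun =
        elimBits s ++ [0] := by
      rw [encodeParity_elimLearner]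
      exact List.map_id _
    rw [this]
    refine congrArg (Turing.TM2.Cfg.mk none (MState.idle true false 0)) ?_
    funext j
    cases j <;> rfl
  exact (congrArg (fun a => (flip Bind.bind (Turing.TM2.step elimProgram))^[t] (some a)) hin).trans
    (h.trans (congrArg some hout.symm))

/-! ### Correctness of the elimination -/

/-- The dot product of two lists. -/
def listDot (r v : Row) : ZMod 2 := (List.zipWith (· * ·) r v).sum

@[simp] lemma listDot_cons (a b : ZMod 2) (r v : Row) :
    listDot (a :: r) (b :: v) = a * b + listDot r v := by simp [listDot]

/-- `w` solves the rows, regarded as homogeneous equations for `w` extended by `1`; in restricting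
mode only the rows that start with `1` count. -/
def Solves (i : Bool) (w : Row) (L : List Row) : Prop :=
  ∀ r ∈ L, (i = true → r.head? = some 1) → listDot r (w ++ [1]) = 0

lemma listDot_addRow {i : Bool} {c : ZMod 2} (hc : i = true → c = 1) {r p v : Row}
    (hp : p.length = r.length) (hv : v.length = r.length) :
    listDot (addRow i c r p) v = listDot r v + c * listDot p v := by
  induction r generalizing p v with
  | nil =>
    obtain rfl := List.length_eq_zero_iff.1 hp
    simp [listDot, addRow]
  | cons s r ih =>
    obtain ⟨t, p, rfl⟩ := List.exists_cons_of_length_eq_add_one hp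
    obtain ⟨a, v, rfl⟩ := List.exists_cons_of_length_eq_add_one hv
    have hm : mixBit i c s t = s + c * t := by
      rw [mixBit, if_neg]
      rintro ⟨h1, h2⟩
      rw [hc h1] at h2
      exact one_ne_zero h2
    simp only [addRow, List.headD_cons, List.tail_cons, listDot_cons, hm,
      ih (by simpa using hp) (by simpa using hv)]
    ring

lemma listDot_addRow_restrict (r p v : Row) : listDot (addRow true 0 r p) v = 0 := by
  induction r generalizing p v with
  | nil => simp [listDot, addRow]
  | cons s r ih =>
    cases v with
    | nil => simp [listDot, addRow]
    | cons a v => simp [addRow, mixBit, ih]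

lemma zmod_two_add_self (a : ZMod 2) : a + a = 0 := CharTwo.add_self_eq_zero a

/-- Invariant of Gauss–Jordan elimination: the active rows have the tuple `w` of remaining unknowns
as their only solution, and the finished rows evaluate at `w` to the values `v` already eliminated.
The pivot row `1 :: p` expresses the leading unknown through the others, and adding it to a row
substitutes this expression. When no unknowns remain, each finished row consists of one entry, the
value of its unknown. -/
lemma elimIter_solution (w v : Row) (i : Bool) (act fin : List Row)
    (hact : ∀ r ∈ act, r.length = w.length + 1) (hsol : Solves i w act)
    (huniq : ∀ u : Row, u.length = w.length → Solves i u act → u = w)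
    (hi : i = true → fin = [])
    (hfin : List.Forall₂ (fun r a => r.length = w.length + 1 ∧ listDot r (w ++ [1]) = a) fin v) :
    leadBits false (elimIter w.length i (act ++ [] :: fin)) = v ++ w := by
  induction w generalizing v i act fin with
  | nil =>
    have : ∀ (fin : List Row) (v : Row),
        List.Forall₂ (fun r a => r.length = 0 + 1 ∧ listDot r ([] ++ [1]) = a) fin v →
        leadBits true fin = v := by
      intro fin v h
      induction h with
      | nil => rfl
      | cons h _ ih =>
        obtain ⟨h1, h2⟩ := h
        obtain ⟨y, rfl⟩ := List.length_eq_one_iff.1 h1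
        simp [leadBits, ih, ← h2, listDot]
    rw [List.append_nil, List.length_nil, elimIter, leadBits_append _ _ (by
      intro r hr h0
      simpa [h0] using hact r hr)]
    exact this fin v hfin
  | cons w0 w ih =>
    have hne : ∀ r ∈ act, r ≠ [] := fun r hr h0 => by
      have := hact r hr
      simp [h0] at this
    obtain ⟨p, act', hpass, hpiv⟩ := elimPass_eq i act fin hne
    have hperm : act.Perm ((1 :: p) :: act') := by
      refine hpiv.resolve_left ?_
      rintro ⟨-, -, hl⟩
      -- Without a pivot no equation involves the leading unknown, so changing its value would give
      -- a second solution.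
      have h1 := huniq ((1 + w0) :: w) rfl (by
        intro r hr hri
        obtain ⟨c, r, rfl⟩ := List.exists_cons_of_ne_nil (hne r hr)
        have hc : c ≠ 1 := fun h => hl _ hr (by simp [h])
        cases i with
        | true => exact absurd (by simpa using hri rfl) hc
        | false =>
          have := hsol _ hr (by simp)
          simp [zmod_two_eq_zero_of_ne_one hc] at this ⊢
          exact this)
      simp at h1
    have hmem : ∀ r, r ∈ act ↔ r = 1 :: p ∨ r ∈ act' := fun r => by
      rw [hperm.mem_iff, List.mem_cons]
    have hplen : p.length = w.length + 1 := by
      simpa using hact _ ((hmem _).2 (Or.inl rfl))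
    have hpsol : listDot p (w ++ [1]) = w0 := by
      have := hsol _ ((hmem _).2 (Or.inl rfl)) (by simp)
      simp only [List.cons_append, listDot_cons, one_mul] at this
      rw [← add_zero (listDot p _), ← zmod_two_add_self w0, ← add_assoc,
        add_comm (listDot p _), this, zero_add]
    have hdot : ∀ (c : ZMod 2) (r u : Row), (i = true → c = 1) → u.length = w.length →
        r.length = w.length + 1 →
        listDot (addRow i c r p) (u ++ [1]) =
          listDot (c :: r) (listDot p (u ++ [1]) :: u ++ [1]) := by
      intro c r u hc hu hr
      rw [listDot_addRow hc (by omega) (by simp; omega)]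
      simp [add_comm]
    have hzero : ∀ (c : ZMod 2) (r u : Row), ¬(i = true → c = 1) →
        listDot (addRow i c r p) u = 0 := by
      intro c r u hc
      obtain ⟨h1, h2⟩ := Classical.not_imp.1 hc
      rw [h1, zmod_two_eq_zero_of_ne_one h2, listDot_addRow_restrict]
    rw [List.length_cons, elimIter, hpass]
    have := ih (v ++ [w0]) false (act'.map (elimRow i p)) (fin.map (elimRow i p) ++ [p])
      ?_ ?_ ?_ (by simp) ?_
    · simpa using this
    · intro r hr
      obtain ⟨r', hr', rfl⟩ := List.mem_map.1 hr
      rw [elimRow_length, hact r' ((hmem _).2 (Or.inr hr'))]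
      simp
    · intro r hr _
      obtain ⟨r', hr', rfl⟩ := List.mem_map.1 hr
      have hra := (hmem _).2 (Or.inr hr')
      obtain ⟨c, r, rfl⟩ := List.exists_cons_of_ne_nil (hne r' hra)
      by_cases hc : i = true → c = 1
      · rw [elimRow, hdot c r w hc rfl (by simpa using hact _ hra), hpsol]
        exact hsol _ hra fun h => by simp [hc h]
      · exact hzero c r _ hc
    · intro u hu hus
      -- A solution of the reduced rows extends to the old ones: the pivot equation prescribes the
      -- leading value.
      have h := huniq (listDot p (u ++ [1]) :: u) (by simp [hu]) (by
        intro r hr hri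
        rcases (hmem r).1 hr with rfl | hr'
        · simp [zmod_two_add_self]
        · obtain ⟨c, r, rfl⟩ := List.exists_cons_of_ne_nil (hne r hr)
          rw [← hdot c r u (fun h => by simpa using hri h) hu (by simpa using hact _ hr)]
          exact hus _ (List.mem_map.2 ⟨_, hr', rfl⟩) (by simp))
      exact (List.cons.inj h).2
    · refine List.rel_append ?_ ?_
      -- The restricting pass would wipe out finished rows, but as the first pass it meets none.
      · cases i with
        | true =>
          obtain rfl := hi rfl
          cases hfin
          exact List.Forall₂.nil
        | false =>
          rw [List.forall₂_map_left_iff]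
          refine hfin.imp fun r a ⟨h1, h2⟩ => ?_
          obtain ⟨c, r, rfl⟩ := List.exists_cons_of_length_eq_add_one h1
          refine ⟨by simpa [elimRow, addRow_length] using h1, ?_⟩
          rw [elimRow, hdot c r w (by simp) rfl (by simpa using h1), hpsol]
          exact h2
      · exact List.Forall₂.cons ⟨hplen, hpsol⟩ List.Forall₂.nil

/-- The sample `s` determines the solutions with `x₀ = 1`: no nonzero linear form vanishes
on all examples whose first bit is `1`. -/
def Determines {d n : ℕ} (s : Fin n → Cube (d + 1)) : Prop :=
  ∀ u : Fin (d + 1) → ZMod 2, (∀ i, s i 0 = true → ∑ j, u j * bit (s i j) = 0) → u = 0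

/-- The coefficients of the linear form that agrees with `f_{S,b}` where `x₀ = 1`. -/
def canonCoeffs {d : ℕ} (S : Finset (Fin (d + 1))) (b : ZMod 2) (j : Fin (d + 1)) : ZMod 2 :=
  (if j ∈ S then 1 else 0) + if j = 0 then b else 0

lemma affParity_eq_sum {d : ℕ} (S : Finset (Fin d)) (b : ZMod 2) (x : Cube d) :
    affParity S b x = b + ∑ j, (if j ∈ S then 1 else 0) * bit (x j) := by
  simp [affParity, Finset.sum_ite_mem]

/-- Where `x₀ = 1`, the bias `b` equals `b * x₀` and can be absorbed into the coefficient of `x₀`.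
-/
lemma sum_canonCoeffs {d : ℕ} (S : Finset (Fin (d + 1))) (b : ZMod 2) {x : Cube (d + 1)}
    (hx : x 0 = true) : ∑ j, canonCoeffs S b j * bit (x j) = affParity S b x := by
  rw [affParity_eq_sum]
  simp only [canonCoeffs, add_mul, Finset.sum_add_distrib, ite_mul, zero_mul,
    Finset.sum_ite_eq', Finset.mem_univ, if_true, hx]
  simp [bit, add_comm]

lemma listDot_ofFn {d : ℕ} (a u : Fin d → ZMod 2) (y : ZMod 2) :
    listDot (List.ofFn a ++ [y]) (List.ofFn u ++ [1]) = ∑ j, u j * a j + y := by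
  rw [listDot, List.zipWith_append (by simp), List.sum_append]
  have : List.zipWith (· * ·) (List.ofFn a) (List.ofFn u) = List.ofFn fun j => a j * u j := by
    apply List.ext_getElem <;> simp
  rw [this, List.sum_ofFn]
  simp [mul_comm]

/-- Replicability in a nutshell: the right-hand side does not involve the sample. -/
lemma elimBits_eq {d n : ℕ} (S : Finset (Fin (d + 1))) (b : ZMod 2) (s : Fin n → Cube (d + 1))
    (hs : Determines s) :
    elimBits (fun i => (s i, affParity S b (s i))) = List.ofFn (canonCoeffs S b) := by
  have hrow : ∀ (u : Fin (d + 1) → ZMod 2) (i : Fin n),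
      listDot (exampleRow (s i, affParity S b (s i))) (List.ofFn u ++ [1]) =
        ∑ j, u j * bit (s i j) + affParity S b (s i) := fun u i => listDot_ofFn _ _ _
  have hhead : ∀ i : Fin n,
      (exampleRow (s i, affParity S b (s i))).head? = some 1 ↔ s i 0 = true := by
    intro i
    cases h : s i 0 <;> simp [exampleRow, List.ofFn_succ, h, bit]
  have key := elimIter_solution (List.ofFn (canonCoeffs S b)) [] true
    (List.ofFn fun i => exampleRow (s i, affParity S b (s i))) [] ?_ ?_ ?_ (by simp)
    List.Forall₂.nil
  · simpa [elimBits, sampleRows] using key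
  · intro r hr
    obtain ⟨i, rfl⟩ := (List.mem_ofFn' _ _).1 hr
    simp [exampleRow_length]
  · intro r hr h
    obtain ⟨i, rfl⟩ := (List.mem_ofFn' _ _).1 hr
    rw [hrow, sum_canonCoeffs S b ((hhead i).1 (h rfl)), zmod_two_add_self]
  · intro u hu hus
    obtain ⟨g, rfl⟩ : ∃ g : Fin (d + 1) → ZMod 2, u = List.ofFn g := by
      have hl : u.length = d + 1 := by simpa using hu
      refine ⟨fun j => u[(j : ℕ)]'(by omega), List.ext_getElem (by simp [hl]) fun j h1 h2 => ?_⟩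
      rw [List.getElem_ofFn]
    congr 1
    -- In characteristic 2 the sum of two solutions is their difference; it vanishes on all examples
    -- with `x₀ = 1`.
    have := hs (fun j => g j + canonCoeffs S b j) (by
      intro i hi
      have h := hus _ ((List.mem_ofFn' _ _).2 ⟨i, rfl⟩) fun _ => (hhead i).2 hi
      rw [hrow] at h
      simpa only [add_mul, Finset.sum_add_distrib, sum_canonCoeffs S b hi] using h)
    funext j
    exact (CharTwo.add_eq_zero).1 (congrFun this j)

/-- On determining samples the learner finds a hypothesis that agrees with the target where
`x₀ = 1`. -/
lemma affParity_elimLearner {d n k : ℕ} (S : Finset (Fin (d + 1))) (b : ZMod 2)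
    (s : Fin n → Cube (d + 1)) (hs : Determines s) (r : Fin k → Bool) {x : Cube (d + 1)}
    (hx : x 0 = true) :
    affParity (elimLearner (fun i => (s i, affParity S b (s i))) r).1
      (elimLearner (fun i => (s i, affParity S b (s i))) r).2 x = affParity S b x := by
  rw [← sum_canonCoeffs S b hx, affParity_eq_sum]
  simp only [elimLearner, elimBits_eq S b s hs, zero_add]
  refine Finset.sum_congr rfl fun j _ => ?_
  congr 1
  simp only [Finset.mem_filter, Finset.mem_univ, true_and]
  rw [List.getElem?_ofFn, dif_pos j.2]
  simp only [Option.some.injEq]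
  split_ifs with h
  · exact h.symm
  · exact (zmod_two_eq_zero_of_ne_one h).symm

/-- On determining samples the output of the learner depends on the target only. -/
lemma elimLearner_eq {d n k : ℕ} (S : Finset (Fin (d + 1))) (b : ZMod 2)
    (s s' : Fin n → Cube (d + 1)) (hs : Determines s) (hs' : Determines s') (r : Fin k → Bool) :
    elimLearner (fun i => (s i, affParity S b (s i))) r =
      elimLearner (fun i => (s' i, affParity S b (s' i))) r := by
  simp only [elimLearner, elimBits_eq S b s hs, elimBits_eq S b s' hs']

/-! ### Correctness of Gaussian elimination -/

/-- `v` satisfies the equation `r`. -/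
def SatEq {m : ℕ} (v : Fin m → ZMod 2) (r : Equation m) : Prop := ∑ k, r.1 k * v k = r.2

lemma SatEq.clearWith {m : ℕ} {v : Fin m → ZMod 2} {p r : Equation m} (j : Fin m)
    (hp : SatEq v p) (hr : SatEq v r) : SatEq v (clearWith j p r) := by
  unfold _root_.clearWith
  split_ifs
  · exact hr
  · simp only [SatEq, Prod.fst_sub, Prod.snd_sub, Pi.sub_apply, sub_mul, Finset.sum_sub_distrib]
    rw [show ∑ k, r.1 k * v k = r.2 from hr, show ∑ k, p.1 k * v k = p.2 from hp]

lemma SatEq.of_clearWith {m : ℕ} {v : Fin m → ZMod 2} {p r : Equation m} {j : Fin m}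
    (hp : SatEq v p) (hr : SatEq v (_root_.clearWith j p r)) : SatEq v r := by
  unfold _root_.clearWith at hr
  split_ifs at hr
  · exact hr
  · simp only [SatEq, Prod.fst_sub, Prod.snd_sub, Pi.sub_apply, sub_mul,
      Finset.sum_sub_distrib] at hr
    rw [show ∑ k, p.1 k * v k = p.2 from hp] at hr
    exact sub_left_inj.1 hr

lemma zmod_two_eq_one_of_ne_zero {c : ZMod 2} (h : c ≠ 0) : c = 1 := by
  revert h; revert c; decide

lemma clearWith_apply_self {m : ℕ} {j : Fin m} {p : Equation m} (hp : p.1 j ≠ 0)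
    (r : Equation m) : (clearWith j p r).1 j = 0 := by
  unfold clearWith
  split_ifs with h
  · exact h
  · simp [zmod_two_eq_one_of_ne_zero hp, zmod_two_eq_one_of_ne_zero h]

lemma clearWith_apply_eq_zero {m : ℕ} {j k : Fin m} {p r : Equation m} (hp : p.1 k = 0)
    (hr : r.1 k = 0) : (clearWith j p r).1 k = 0 := by
  unfold clearWith
  split_ifs <;> simp [hp, hr]

lemma satEq_update {m : ℕ} {j : Fin m} {r : Equation m} (hr : r.1 j = 0) (v : Fin m → ZMod 2)
    (a : ZMod 2) : SatEq (Function.update v j a) r ↔ SatEq v r := by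
  have : ∀ k, r.1 k * Function.update v j a k = r.1 k * v k := fun k => by
    by_cases hk : k = j
    · subst hk; simp [hr]
    · rw [Function.update_of_ne hk]
  simp only [SatEq, this]

/-- Elimination with back substitution solves consistent systems. -/
lemma backSubst_satEq {m : ℕ} (free w : Fin m → ZMod 2) (js : List (Fin m))
    (rows : List (Equation m)) (hw : ∀ r ∈ rows, SatEq w r)
    (hz : ∀ r ∈ rows, ∀ k, k ∉ js → r.1 k = 0) :
    ∀ r ∈ rows, SatEq (backSubst free (forwardElim js rows)) r := by
  induction js generalizing rows with
  | nil =>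
    intro r hr
    -- All unknowns have been eliminated, so each equation has left side `0`, and the solution `w`
    -- forces its right side to be `0`.
    have h0 : ∀ k, r.1 k = 0 := fun k => hz r hr k (by simp)
    have := hw r hr
    simpa [SatEq, h0] using this
  | cons j js ih =>
    cases hf : rows.find? (fun r => decide (r.1 j ≠ 0)) with
    | none =>
      have h0 : ∀ r ∈ rows, r.1 j = 0 := by simpa using hf
      rw [forwardElim, hf]
      refine ih rows hw fun r hr k hk => ?_
      by_cases hkj : k = j
      · exact hkj ▸ h0 r hr
      · exact hz r hr k (by simp [hkj, hk])
    | some p =>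
      have hpj : p.1 j ≠ 0 := by simpa using List.find?_some hf
      have hpm : p ∈ rows := List.mem_of_find?_eq_some hf
      have hrec := ih (rows.map (clearWith j p))
        (by
          intro r hr
          obtain ⟨r, hr', rfl⟩ := List.mem_map.1 hr
          exact (hw p hpm).clearWith j (hw r hr'))
        (by
          intro r hr k hk
          obtain ⟨r, hr', rfl⟩ := List.mem_map.1 hr
          by_cases hkj : k = j
          · exact hkj ▸ clearWith_apply_self hpj r
          · exact clearWith_apply_eq_zero (hz p hpm k (by simp [hkj, hk]))
              (hz r hr' k (by simp [hkj, hk])))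
      rw [forwardElim, hf]
      simp only [backSubst]
      set v := backSubst free (forwardElim js (rows.map (clearWith j p))) with hv
      have hp : SatEq (Function.update v j
          (p.2 - ∑ k ∈ Finset.univ.erase j, p.1 k * v k)) p := by
        rw [SatEq, ← Finset.add_sum_erase _ _ (Finset.mem_univ j), Function.update_self,
          zmod_two_eq_one_of_ne_zero hpj, one_mul]
        refine Eq.trans (congrArg _ (Finset.sum_congr rfl fun k hk => ?_)) (sub_add_cancel _ _)
        rw [Function.update_of_ne (Finset.ne_of_mem_erase hk)]
      intro r hr
      exact hp.of_clearWith ((satEq_update (clearWith_apply_self hpj r) _ _).2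
        (hrec _ (List.mem_map.2 ⟨r, hr, rfl⟩)))

lemma gaussSolve_satEq {m : ℕ} (free w : Fin m → ZMod 2) (rows : List (Equation m))
    (hw : ∀ r ∈ rows, SatEq w r) : ∀ r ∈ rows, SatEq (gaussSolve free rows) r :=
  backSubst_satEq free w _ rows hw fun _ _ k hk => absurd (List.mem_finRange k) hk

/-! ### Free unknowns -/

lemma backSubst_of_notMem {m : ℕ} (free : Fin m → ZMod 2) {j : Fin m}
    (ps : List (Fin m × Equation m)) (h : ∀ q ∈ ps, q.1 ≠ j) : backSubst free ps j = free j := by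
  induction ps with
  | nil => rfl
  | cons q ps ih =>
    rw [backSubst, Function.update_of_ne (h q (by simp)).symm]
    exact ih fun q' hq' => h q' (by simp [hq'])

lemma forwardElim_ne_of_zero {m : ℕ} {j : Fin m} (js : List (Fin m)) (rows : List (Equation m))
    (h : ∀ r ∈ rows, r.1 j = 0) : ∀ q ∈ forwardElim js rows, q.1 ≠ j := by
  induction js generalizing rows with
  | nil => simp [forwardElim]
  | cons k js ih =>
    cases hf : rows.find? (fun r => decide (r.1 k ≠ 0)) with
    | none =>
      rw [forwardElim, hf]
      exact ih rows h
    | some p =>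
      have hpk : p.1 k ≠ 0 := by simpa using List.find?_some hf
      have hpj := h p (List.mem_of_find?_eq_some hf)
      rw [forwardElim, hf]
      intro q hq
      rcases List.mem_cons.1 hq with rfl | hq
      · rintro rfl
        exact hpk hpj
      · refine ih _ (fun r hr => ?_) q hq
        obtain ⟨r, hr', rfl⟩ := List.mem_map.1 hr
        exact clearWith_apply_eq_zero hpj (h r hr')

/-- Of two equal columns the second one never has a pivot. -/
lemma forwardElim_ne_of_eq {m : ℕ} {i j : Fin m} (hij : i < j) (js : List (Fin m))
    (hjs : js.Pairwise (· < ·)) (hi : i ∈ js) (rows : List (Equation m))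
    (h : ∀ r ∈ rows, r.1 i = r.1 j) : ∀ q ∈ forwardElim js rows, q.1 ≠ j := by
  induction js generalizing rows with
  | nil => simp [forwardElim]
  | cons k js ih =>
    rw [List.pairwise_cons] at hjs
    have hkj : k ≠ j := by
      rcases List.mem_cons.1 hi with rfl | hi
      · exact hij.ne
      · exact ((hjs.1 i hi).trans hij).ne
    cases hf : rows.find? (fun r => decide (r.1 k ≠ 0)) with
    | none =>
      rw [forwardElim, hf]
      rcases List.mem_cons.1 hi with rfl | hi
      · have h0 : ∀ r ∈ rows, r.1 i = 0 := by simpa using hf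
        exact forwardElim_ne_of_zero _ _ fun r hr => by rw [← h r hr, h0 r hr]
      · exact ih hjs.2 hi rows h
    | some p =>
      have hpk : p.1 k ≠ 0 := by simpa using List.find?_some hf
      have hpm := List.mem_of_find?_eq_some hf
      have hcl : ∀ r ∈ rows.map (clearWith k p), r.1 i = r.1 j := by
        intro r hr
        obtain ⟨r, hr', rfl⟩ := List.mem_map.1 hr
        unfold clearWith
        split_ifs
        · exact h r hr'
        · simp [h r hr', h p hpm]
      rw [forwardElim, hf]
      intro q hq
      rcases List.mem_cons.1 hq with rfl | hq
      · exact hkj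
      · rcases List.mem_cons.1 hi with rfl | hi
        -- The pivot for `i` clears column `i`. The columns stay equal, so column `j` is cleared as
        -- well.
        · refine forwardElim_ne_of_zero _ _ (fun r hr => ?_) q hq
          rw [← hcl r hr]
          obtain ⟨r, -, rfl⟩ := List.mem_map.1 hr
          exact clearWith_apply_self hpk r
        · exact ih hjs.2 hi _ hcl q hq

/-- Used with `i` the column of `x₀` and `j` that of the bias, which coincide when `x₀ = 1`
throughout. -/
lemma gaussSolve_last {m : ℕ} {i j : Fin m} (hij : i < j) (free : Fin m → ZMod 2)
    (rows : List (Equation m)) (h : ∀ r ∈ rows, r.1 i = r.1 j) : gaussSolve free rows j = free j :=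
  backSubst_of_notMem _ _ (forwardElim_ne_of_eq hij _ (List.pairwise_lt_finRange m)
    (List.mem_finRange i) rows h)

/-! ### The Gaussian elimination learner -/

lemma ofCoeffs_apply {d : ℕ} (v : Fin (d + 1) → ZMod 2) (x : Cube d) :
    ofCoeffs v x = ∑ j : Fin d, v j.castSucc * bit (x j) + v (Fin.last d) := by
  rw [ofCoeffs, affParity_eq_sum, add_comm]
  congr 1
  refine Finset.sum_congr rfl fun j _ => ?_
  congr 1
  simp only [Finset.mem_filter, Finset.mem_univ, true_and]
  split_ifs with h
  · exact h.symm
  · exact (zmod_two_eq_zero_of_ne_one h).symm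

lemma satEq_exampleEquation {d : ℕ} (v : Fin (d + 1) → ZMod 2) (e : Example d) :
    SatEq v (exampleEquation e) ↔ ofCoeffs v e.1 = e.2 := by
  simp only [SatEq, exampleEquation, Fin.sum_univ_castSucc, Fin.snoc_castSucc, Fin.snoc_last,
    mul_one, ofCoeffs_apply, mul_comm]

lemma exists_ofCoeffs_eq {d : ℕ} (S : Finset (Fin d)) (b : ZMod 2) :
    ∃ v : Fin (d + 1) → ZMod 2, ofCoeffs v = affParity S b := by
  refine ⟨Fin.snoc (α := fun _ => ZMod 2) (fun j => if j ∈ S then 1 else 0) b, ?_⟩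
  funext x
  simp only [ofCoeffs_apply, Fin.snoc_castSucc, Fin.snoc_last, affParity_eq_sum, add_comm]

lemma gaussLearner_apply_sample {d n k : ℕ}
    (tie : (Fin n → Example d) → (Fin k → Bool) → (Fin (d + 1) → ZMod 2)) (S : Finset (Fin d))
    (b : ZMod 2) (s : Fin n → Cube d) (r : Fin k → Bool) (i : Fin n) :
    gaussLearner tie (fun i => (s i, affParity S b (s i))) r (s i) = affParity S b (s i) := by
  obtain ⟨v, hv⟩ := exists_ofCoeffs_eq S b
  have h := gaussSolve_satEq (tie (fun i => (s i, affParity S b (s i))) r) v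
    (List.ofFn fun i => exampleEquation (s i, affParity S b (s i)))
    (by
      intro q hq
      obtain ⟨i, rfl⟩ := (List.mem_ofFn' _ _).1 hq
      rw [satEq_exampleEquation, hv])
    _ ((List.mem_ofFn' _ _).2 ⟨i, rfl⟩)
  exact (satEq_exampleEquation _ _).1 h

/-- Affine parities that agree on a determining sample with an example where `x₀ = 0` are equal. -/
lemma ofCoeffs_eq_of_determines {d n : ℕ} {s : Fin n → Cube (d + 1)} (hs : Determines s)
    (h0 : ∃ i, s i 0 = false) {v w : Fin (d + 2) → ZMod 2}
    (h : ∀ i, ofCoeffs v (s i) = ofCoeffs w (s i)) : ofCoeffs v = ofCoeffs w := by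
  set l : ZMod 2 := v (Fin.last _) - w (Fin.last _) with hl
  have hdiff : ∀ i, ∑ j : Fin (d + 1), (v j.castSucc - w j.castSucc) * bit (s i j) + l = 0 := by
    intro i
    have := sub_eq_zero.2 (h i)
    rw [ofCoeffs_apply, ofCoeffs_apply] at this
    simp only [sub_mul, Finset.sum_sub_distrib, hl]
    rw [← this]
    ring
  -- The constant `l` of the difference is moved into the coefficient of `x₀`.
  have hg := hs (fun j => (v j.castSucc - w j.castSucc) + if j = 0 then l else 0) (by
    intro i hi
    refine Eq.trans ?_ (hdiff i)
    simp only [add_mul, Finset.sum_add_distrib, ite_mul, zero_mul, Finset.sum_ite_eq',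
      Finset.mem_univ, if_true, hi]
    simp [bit])
  obtain ⟨i, hi⟩ := h0
  -- At the example with `x₀ = 0` only the constant of the difference remains.
  have hl0 : l = 0 := by
    rw [← hdiff i, Finset.sum_eq_zero, zero_add]
    intro j _
    by_cases hj : j = 0
    · subst hj
      simp [hi, bit]
    · have := congrFun hg j
      simp only [hj, if_false, add_zero, Pi.zero_apply] at this
      rw [this, zero_mul]
  funext x
  rw [ofCoeffs_apply, ofCoeffs_apply, sub_eq_zero.1 hl0]
  congr 1
  refine Finset.sum_congr rfl fun j _ => ?_
  have := congrFun hg j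
  simp only [hl0, ite_self, add_zero, Pi.zero_apply] at this
  rw [sub_eq_zero.1 this]

lemma gaussLearner_eq {d n k : ℕ}
    (tie : (Fin n → Example (d + 1)) → (Fin k → Bool) → (Fin (d + 2) → ZMod 2))
    (S : Finset (Fin (d + 1))) (b : ZMod 2) {s : Fin n → Cube (d + 1)} (hs : Determines s)
    (h0 : ∃ i, s i 0 = false) (r : Fin k → Bool) :
    gaussLearner tie (fun i => (s i, affParity S b (s i))) r = affParity S b := by
  obtain ⟨v, hv⟩ := exists_ofCoeffs_eq S b
  rw [← hv]
  refine ofCoeffs_eq_of_determines hs h0 fun i => ?_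
  rw [hv]
  exact gaussLearner_apply_sample tie S b s r i

/-- If `x₀ = 1` in all examples, then the bias is a free unknown. -/
lemma gaussLearner_zero {d n k : ℕ}
    (tie : (Fin n → Example (d + 1)) → (Fin k → Bool) → (Fin (d + 2) → ZMod 2))
    (s : Fin n → Example (d + 1)) (hs : ∀ i, (s i).1 0 = true) (r : Fin k → Bool) :
    gaussLearner tie s r (fun _ => false) = tie s r (Fin.last _) := by
  rw [gaussLearner, ofCoeffs_apply, gaussSolve_last (i := (0 : Fin (d + 1)).castSucc)
    (Fin.castSucc_lt_last _)]
  · simp [bit]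
  · intro q hq
    obtain ⟨i, rfl⟩ := (List.mem_ofFn' _ _).1 hq
    simp only [exampleEquation, Fin.snoc_castSucc, Fin.snoc_last, hs i]
    rfl

/-! ### A product distribution with one biased coordinate -/

/-- The success probabilities `θ` for the first coordinate and `1/2` for the others. -/
noncomputable def biasedCoords (d : ℕ) (θ : unitInterval) (j : Fin d) : unitInterval :=
  if (j : ℕ) = 0 then θ else ⟨1 / 2, by norm_num, by norm_num⟩

instance {d : ℕ} (p : Fin d → unitInterval) : IsProbabilityMeasure (prodDist p) := by
  unfold prodDist; infer_instance

instance {d : ℕ} (D : Measure (Cube d)) [IsProbabilityMeasure D] (f : Cube d → ZMod 2) :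
    IsProbabilityMeasure (labelled D f) :=
  Measure.isProbabilityMeasure_map Measurable.of_discrete.aemeasurable

instance {Z : Type} [MeasurableSpace Z] (P : Measure Z) [IsProbabilityMeasure P] (n : ℕ) :
    IsProbabilityMeasure (iidLaw P n) := by
  unfold iidLaw; infer_instance

instance (k : ℕ) : IsProbabilityMeasure (uniformBits k) := by
  unfold uniformBits; infer_instance

lemma isMonotoneDist_prodDist {d : ℕ} {p : Fin d → unitInterval}
    (hp : ∀ j, (1 / 2 : ℝ) ≤ p j) : IsMonotoneDist (prodDist p) := by
  intro x y hyx
  rw [prodDist, Measure.pi_singleton, Measure.pi_singleton]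
  refine Finset.prod_le_prod' fun j _ => ?_
  have hj := hyx j
  rw [← ENNReal.toReal_le_toReal (by simp) (by simp)]
  change (bernoulliMeasure true false (p j)).real _ ≤ (bernoulliMeasure true false (p j)).real _
  have := hp j
  cases hx : x j <;> cases hy : y j
  · simp
  · rw [hx, hy] at hj
    exact absurd (hj rfl) Bool.false_ne_true
  · simp
    linarith
  · simp

lemma real_first_coord {d : ℕ} (p : Fin (d + 1) → unitInterval) :
    (prodDist p).real {x | x 0 = true} = p 0 := by
  have h := (measurePreserving_eval (fun i => bernoulliMeasure true false (p i)) 0)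
  have := h.measureReal_preimage (s := {true}) (MeasurableSet.of_discrete.nullMeasurableSet)
  rw [prodDist]
  refine Eq.trans ?_ (this.trans (by simp))
  rfl

/-- Negate one coordinate. -/
def flipCoord {d : ℕ} (j : Fin d) (x : Cube d) : Cube d := fun i => if i = j then !(x i) else x i

/-- This symmetry gives both the lower bound for nonzero forms and the orthogonality of parities. -/
lemma measurePreserving_flipCoord {d : ℕ} {p : Fin d → unitInterval} {j : Fin d}
    (hj : (p j : ℝ) = 1 / 2) : MeasurePreserving (flipCoord j) (prodDist p) (prodDist p) := by
  have key : ∀ i, MeasurePreserving (fun b : Bool => if i = j then !b else b)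
      (bernoulliMeasure true false (p i)) (bernoulliMeasure true false (p i)) := by
    intro i
    by_cases hi : i = j
    · subst hi
      simp only [if_true]
      refine ⟨Measurable.of_discrete, ?_⟩
      refine Measure.ext_of_singleton fun b => ?_
      rw [Measure.map_apply Measurable.of_discrete MeasurableSet.of_discrete,
        ← ENNReal.toReal_eq_toReal_iff' (by simp) (by simp)]
      change (bernoulliMeasure true false (p i)).real _ = (bernoulliMeasure true false (p i)).real _
      cases b <;> simp [hj] <;> norm_num
    · simp only [hi, if_false]
      exact MeasurePreserving.id _
  exact measurePreserving_pi _ _ key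

lemma sum_flipCoord {d : ℕ} (u : Fin d → ZMod 2) {j : Fin d} (hj : u j = 1) (x : Cube d) :
    ∑ i, u i * bit (flipCoord j x i) = ∑ i, u i * bit (x i) + 1 := by
  have : ∀ i, u i * bit (flipCoord j x i) = u i * bit (x i) + if i = j then 1 else 0 := by
    intro i
    by_cases hi : i = j
    · subst hi
      have h2 : (1 : ZMod 2) + 1 = 0 := rfl
      cases h : x i <;> simp [flipCoord, hj, h, bit, h2]
    · simp [flipCoord, hi]
  simp [this, Finset.sum_add_distrib]

/-- A nonzero linear form is not zero on the half cube `x₀ = 1` with good probability. -/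
lemma le_real_form_ne_zero {d : ℕ} {θ : unitInterval} (hθ : (1 / 2 : ℝ) ≤ θ)
    {u : Fin (d + 1) → ZMod 2} (hu : u ≠ 0) :
    1 / 4 ≤ (prodDist (biasedCoords (d + 1) θ)).real
      {x | x 0 = true ∧ ∑ j, u j * bit (x j) ≠ 0} := by
  set D := prodDist (biasedCoords (d + 1) θ) with hD
  have h0 : D.real {x | x 0 = true} = θ := by
    rw [hD, real_first_coord]
    simp [biasedCoords]
  by_cases h : ∃ j, j ≠ 0 ∧ u j ≠ 0
  · obtain ⟨j, hj0, hj⟩ := h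
    have hj1 := zmod_two_eq_one_of_ne_zero hj
    have hmp : MeasurePreserving (flipCoord j) D D := measurePreserving_flipCoord (by
      have : (j : ℕ) ≠ 0 := fun h => hj0 (Fin.ext h)
      simp [biasedCoords, this])
    have hpre := hmp.measureReal_preimage (s := {x | x 0 = true ∧ ∑ j, u j * bit (x j) ≠ 0})
      MeasurableSet.of_discrete.nullMeasurableSet
    -- Flipping a fair bit that occurs in the form toggles its value and keeps `x₀`, so the form is
    -- nonzero on half of the mass `θ` of the half cube.
    have hcov : {x : Cube (d + 1) | x 0 = true} ⊆
        {x | x 0 = true ∧ ∑ j, u j * bit (x j) ≠ 0} ∪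
          flipCoord j ⁻¹' {x | x 0 = true ∧ ∑ j, u j * bit (x j) ≠ 0} := by
      intro x hx
      by_cases hs : ∑ j, u j * bit (x j) = 0
      · right
        refine ⟨?_, ?_⟩
        · simpa [flipCoord, hj0.symm] using hx
        · rw [sum_flipCoord u hj1, hs]
          simp
      · exact Or.inl ⟨hx, hs⟩
    have := (measureReal_mono (μ := D) hcov).trans (measureReal_union_le _ _)
    rw [h0, hpre] at this
    linarith
  · push Not at h
    have hu0 : u 0 ≠ 0 := by
      intro h0
      apply hu
      funext j
      by_cases hj : j = 0
      · exact hj ▸ h0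
      · exact h j hj
    -- Here the form is `x₀` itself.
    have : {x : Cube (d + 1) | x 0 = true} ⊆ {x | x 0 = true ∧ ∑ j, u j * bit (x j) ≠ 0} := by
      intro x hx
      refine ⟨hx, ?_⟩
      rw [Finset.sum_eq_single 0 (fun j _ hj => by rw [h j hj, zero_mul]) (by simp),
        zmod_two_eq_one_of_ne_zero hu0, show x 0 = true from hx]
      simp [bit]
    have := measureReal_mono (μ := D) this
    rw [h0] at this
    linarith

lemma real_iidLaw_forall {Z : Type} [MeasurableSpace Z] (P : Measure Z) [IsProbabilityMeasure P]
    (n : ℕ) (B : Set Z) : (iidLaw P n).real {s | ∀ i, s i ∈ B} = P.real B ^ n := by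
  have : {s : Fin n → Z | ∀ i, s i ∈ B} = Set.pi Set.univ fun _ => B := by
    ext s; simp
  rw [this, measureReal_def, iidLaw, Measure.pi_pi]
  simp [measureReal_def]

/-- Union bound over the nonzero forms: each single example refutes a given form with probability at
least `1/4`. -/
lemma real_not_determines_le {d : ℕ} {θ : unitInterval} (hθ : (1 / 2 : ℝ) ≤ θ) (n : ℕ) :
    (iidLaw (prodDist (biasedCoords (d + 1) θ)) n).real {s | ¬ Determines s} ≤
      2 ^ (d + 1) * (3 / 4) ^ n := by
  set D := prodDist (biasedCoords (d + 1) θ) with hD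
  set F : Finset (Fin (d + 1) → ZMod 2) := Finset.univ.filter fun u => u ≠ 0
  set B : (Fin (d + 1) → ZMod 2) → Set (Cube (d + 1)) :=
    fun u => {x | x 0 = true ∧ ∑ j, u j * bit (x j) ≠ 0}ᶜ with hB
  have hsub : {s : Fin n → Cube (d + 1) | ¬ Determines s} ⊆
      ⋃ u ∈ F, {s | ∀ i, s i ∈ B u} := by
    intro s hs
    simp only [Determines, Set.mem_ofPred_eq, not_forall] at hs
    obtain ⟨u, h, hu⟩ := hs
    simp only [Set.mem_iUnion]
    refine ⟨u, by simpa [F] using hu, fun i => ?_⟩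
    simpa [B] using h i
  refine (measureReal_mono hsub (measure_ne_top _ _)).trans ((measureReal_biUnion_finset_le _ _).trans ?_)
  have hle : ∀ u ∈ F, (iidLaw D n).real {s | ∀ i, s i ∈ B u} ≤ (3 / 4) ^ n := by
    intro u hu
    rw [real_iidLaw_forall]
    refine pow_le_pow_left₀ measureReal_nonneg ?_ n
    rw [hB, probReal_compl_eq_one_sub MeasurableSet.of_discrete]
    have := le_real_form_ne_zero hθ (d := d) (u := u) (by simpa [F] using hu)
    linarith
  refine (Finset.sum_le_card_nsmul _ _ _ hle).trans ?_
  rw [nsmul_eq_mul]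
  have hcard : (F.card : ℝ) ≤ 2 ^ (d + 1) := by
    have := Finset.card_le_univ F
    rw [Fintype.card_fun, ZMod.card, Fintype.card_fin] at this
    exact_mod_cast this
  gcongr

/-! ### Labelled samples -/

lemma iidLaw_labelled {d : ℕ} (D : Measure (Cube d)) [IsProbabilityMeasure D]
    (f : Cube d → ZMod 2) (n : ℕ) :
    iidLaw (labelled D f) n = (iidLaw D n).map fun s i => (s i, f (s i)) := by
  rw [iidLaw, iidLaw]
  exact (Measure.pi_map_pi fun _ => Measurable.of_discrete.aemeasurable).symm

section Disagreement

variable {d n k : ℕ} {H : Type} (D : Measure (Cube d)) [IsProbabilityMeasure D]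
  (f : Cube d → ZMod 2) (R : Measure (Fin k → Bool))
  (A : (Fin n → Example d) → (Fin k → Bool) → H)

lemma disagreement_labelled : disagreement (labelled D f) R A =
    ((iidLaw D n).prod ((iidLaw D n).prod R)).real
      {t | A (fun i => (t.1 i, f (t.1 i))) t.2.2 ≠ A (fun i => (t.2.1 i, f (t.2.1 i))) t.2.2} := by
  set L : (Fin n → Cube d) → (Fin n → Example d) := fun s i => (s i, f (s i))
  have hL : Measurable L := Measurable.of_discrete
  have : (iidLaw (labelled D f) n).prod ((iidLaw (labelled D f) n).prod R) =
      ((iidLaw D n).prod ((iidLaw D n).prod R)).map (Prod.map L (Prod.map L id)) := by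
    rw [iidLaw_labelled]
    conv_lhs => rw [← Measure.map_id (μ := R)]
    rw [Measure.map_prod_map _ _ hL measurable_id,
      Measure.map_prod_map _ _ hL (hL.prodMap measurable_id)]
  rw [disagreement, this, map_measureReal_apply (hL.prodMap (hL.prodMap measurable_id))
    MeasurableSet.of_discrete]
  rfl

variable [IsProbabilityMeasure R]

/-- The first sample is independent of the second sample together with the shared random string. In
the applications `G` forces the output `f` for every random string, and `W` forces a different
output. -/
lemma mul_le_disagreement (G : Set (Fin n → Cube d)) (W : Set ((Fin n → Cube d) × (Fin k → Bool)))
    (h : ∀ s ∈ G, ∀ t ∈ W,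
      A (fun i => (s i, f (s i))) t.2 ≠ A (fun i => (t.1 i, f (t.1 i))) t.2) :
    (iidLaw D n).real G * ((iidLaw D n).prod R).real W ≤ disagreement (labelled D f) R A := by
  rw [disagreement_labelled, ← measureReal_prod_prod]
  exact measureReal_mono fun t ht => h t.1 ht.1 t.2 ht.2

lemma disagreement_le (G : Set (Fin n → Cube d))
    (h : ∀ s ∈ G, ∀ s' ∈ G, ∀ r,
      A (fun i => (s i, f (s i))) r = A (fun i => (s' i, f (s' i))) r) :
    disagreement (labelled D f) R A ≤ 2 * (iidLaw D n).real Gᶜ := by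
  rw [disagreement_labelled]
  have hsub : {t : (Fin n → Cube d) × (Fin n → Cube d) × (Fin k → Bool) |
      A (fun i => (t.1 i, f (t.1 i))) t.2.2 ≠ A (fun i => (t.2.1 i, f (t.2.1 i))) t.2.2} ⊆
      Gᶜ ×ˢ Set.univ ∪ Set.univ ×ˢ (Gᶜ ×ˢ Set.univ) := by
    intro t ht
    by_contra hc
    simp only [Set.mem_union, Set.mem_prod, Set.mem_compl_iff, Set.mem_univ, and_true, true_and,
      not_or, not_not] at hc
    exact ht (h _ hc.1 _ hc.2 _)
  refine (measureReal_mono hsub).trans ((measureReal_union_le _ _).trans ?_)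
  rw [measureReal_prod_prod, measureReal_prod_prod, measureReal_prod_prod]
  simp only [probReal_univ]
  linarith

lemma le_real_prod_labelled (G : Set (Fin n → Cube d))
    (Q : Set ((Fin n → Example d) × (Fin k → Bool)))
    (h : ∀ s ∈ G, ∀ r, ((fun i => (s i, f (s i))), r) ∈ Q) :
    (iidLaw D n).real G ≤ ((iidLaw (labelled D f) n).prod R).real Q := by
  set L : (Fin n → Cube d) → (Fin n → Example d) := fun s i => (s i, f (s i))
  have hL : Measurable L := Measurable.of_discrete
  have : (iidLaw (labelled D f) n).prod R = ((iidLaw D n).prod R).map (Prod.map L id) := by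
    rw [iidLaw_labelled]
    conv_lhs => rw [← Measure.map_id (μ := R)]
    rw [Measure.map_prod_map _ _ hL measurable_id]
  rw [this, map_measureReal_apply (hL.prodMap measurable_id) MeasurableSet.of_discrete]
  have h1 : (iidLaw D n).real G = ((iidLaw D n).prod R).real (G ×ˢ Set.univ) := by
    rw [measureReal_prod_prod, probReal_univ, mul_one]
  rw [h1]
  exact measureReal_mono fun t ht => h t.1 ht.1 t.2

end Disagreement

/-- Flipping bit `j` preserves the uniform law and exchanges the event with its complement. -/
lemma real_uniformBits_ne {k : ℕ} (j : Fin k) (b : ZMod 2) :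
    (uniformBits k).real {r | bit (r j) ≠ b} = 1 / 2 := by
  classical
  have hflip : MeasurePreserving (flipCoord j) (uniformBits k) (uniformBits k) := by
    refine ⟨Measurable.of_discrete, Measure.ext_of_singleton fun x => ?_⟩
    rw [Measure.map_apply Measurable.of_discrete MeasurableSet.of_discrete]
    have hpre : flipCoord j ⁻¹' {x} = {flipCoord j x} := by
      have hinv : Function.Involutive (flipCoord (d := k) j) := by
        intro x
        funext i
        by_cases hi : i = j <;> simp [flipCoord, hi]
      ext y
      simp only [Set.mem_preimage, Set.mem_singleton_iff]
      exact hinv.eq_iff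
    rw [hpre, uniformBits, PMF.toMeasure_apply_singleton _ _ (MeasurableSet.singleton _),
      PMF.toMeasure_apply_singleton _ _ (MeasurableSet.singleton _)]
    simp
  have hpre := hflip.measureReal_preimage (s := {r | bit (r j) ≠ b})
    MeasurableSet.of_discrete.nullMeasurableSet
  have hc : flipCoord j ⁻¹' {r : Fin k → Bool | bit (r j) ≠ b} = {r | bit (r j) ≠ b}ᶜ := by
    ext r
    have : ∀ (c : Bool) (b : ZMod 2), bit (!c) ≠ b ↔ ¬ bit c ≠ b := by decide
    simpa [flipCoord] using this (r j) b
  rw [hc, probReal_compl_eq_one_sub MeasurableSet.of_discrete] at hpre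
  linarith

/-! ### Parities and statistical queries -/

/-- The sign `(-1)^y` of a bit. -/
def bitSign (y : ZMod 2) : ℝ := if y = 0 then 1 else -1

lemma bitSign_add (a b : ZMod 2) : bitSign (a + b) = bitSign a * bitSign b := by
  have h : ∀ a b : ZMod 2, (a + b = 0 ↔ a = b) := by decide
  have h' : ∀ a b : ZMod 2, a ≠ 0 → b ≠ 0 → a = b := by decide
  unfold bitSign
  by_cases ha : a = 0 <;> by_cases hb : b = 0
  · simp [ha, hb]
  · simp [ha, hb]
  · simp [ha, hb]
  · simp [ha, hb, (h a b).2 (h' a b ha hb)]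

lemma bitSign_mul_self (a : ZMod 2) : bitSign a * bitSign a = 1 := by
  unfold bitSign; split_ifs <;> norm_num

lemma abs_bitSign (a : ZMod 2) : |bitSign a| = 1 := by
  unfold bitSign; split_ifs <;> norm_num

section Cube

variable {d : ℕ} (D : Measure (Cube d)) [IsProbabilityMeasure D]

lemma integrable_cube (g : Cube d → ℝ) : Integrable g D := Integrable.of_finite

/-- Bessel's inequality. -/
lemma sum_sq_integral_le {ι : Type*} [DecidableEq ι] (F : Finset ι) (χ : ι → Cube d → ℝ)
    (hχ : ∀ a ∈ F, ∀ b ∈ F, ∫ x, χ a x * χ b x ∂D = if a = b then 1 else 0)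
    (g : Cube d → ℝ) (hg : ∀ x, |g x| ≤ 1) : ∑ a ∈ F, (∫ x, g x * χ a x ∂D) ^ 2 ≤ 1 := by
  set c : ι → ℝ := fun a => ∫ x, g x * χ a x ∂D with hc
  have h1 : ∫ x, g x * ∑ a ∈ F, c a * χ a x ∂D = ∑ a ∈ F, c a ^ 2 := by
    simp_rw [Finset.mul_sum]
    rw [integral_finsetSum _ fun a _ => integrable_cube D _]
    refine Finset.sum_congr rfl fun a _ => ?_
    simp_rw [mul_left_comm _ (c a)]
    rw [integral_const_mul, sq]
  have h2 : ∫ x, (∑ a ∈ F, c a * χ a x) * ∑ b ∈ F, c b * χ b x ∂D = ∑ a ∈ F, c a ^ 2 := by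
    simp_rw [Finset.sum_mul_sum]
    rw [integral_finsetSum _ fun a _ => integrable_cube D _]
    refine Finset.sum_congr rfl fun a ha => ?_
    rw [integral_finsetSum _ fun a _ => integrable_cube D _]
    rw [Finset.sum_congr rfl fun b hb => show ∫ x, c a * χ a x * (c b * χ b x) ∂D =
        if a = b then c a * c b else 0 from ?_]
    · simp [ha, sq]
    · rw [integral_congr_ae (ae_of_all _ fun x => mul_mul_mul_comm (c a) (χ a x) (c b) (χ b x)),
        integral_const_mul, hχ a ha b hb]
      simp
  have h3 : ∫ x, g x * g x ∂D ≤ 1 := by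
    refine (integral_mono (integrable_cube D _) (integrable_const 1) fun x => ?_).trans (by simp)
    have := abs_le.1 (hg x)
    change g x * g x ≤ 1
    nlinarith
  -- The residual of the projection onto the span has nonnegative square norm.
  have h4 : 0 ≤ ∫ x, (g x - ∑ a ∈ F, c a * χ a x) * (g x - ∑ a ∈ F, c a * χ a x) ∂D :=
    integral_nonneg fun x => mul_self_nonneg _
  have h5 : ∫ x, (g x - ∑ a ∈ F, c a * χ a x) * (g x - ∑ a ∈ F, c a * χ a x) ∂D =
      ∫ x, g x * g x ∂D - 2 * (∫ x, g x * ∑ a ∈ F, c a * χ a x ∂D) +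
        ∫ x, (∑ a ∈ F, c a * χ a x) * ∑ b ∈ F, c b * χ b x ∂D := by
    rw [← integral_const_mul, ← integral_sub (integrable_cube D _) (integrable_cube D _),
      ← integral_add (integrable_cube D _) (integrable_cube D _)]
    refine integral_congr_ae (ae_of_all _ fun x => ?_)
    ring
  rw [h5, h1, h2] at h4
  linarith

/-- Each counted index contributes at least `τ ^ 2` to Bessel's sum. -/
lemma card_filter_integral_le {ι : Type*} [DecidableEq ι] (F : Finset ι) (χ : ι → Cube d → ℝ)
    (hχ : ∀ a ∈ F, ∀ b ∈ F, ∫ x, χ a x * χ b x ∂D = if a = b then 1 else 0)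
    (g : Cube d → ℝ) (hg : ∀ x, |g x| ≤ 1) {τ : ℝ} (hτ : 0 < τ)
    [DecidablePred fun a => τ ≤ |∫ x, g x * χ a x ∂D|] :
    ((F.filter fun a => τ ≤ |∫ x, g x * χ a x ∂D|).card : ℝ) ≤ 1 / τ ^ 2 := by
  rw [le_div_iff₀ (by positivity), ← nsmul_eq_mul]
  refine le_trans ?_ (sum_sq_integral_le D F χ hχ g hg)
  refine (Finset.card_nsmul_le_sum _ _ _ fun a ha => ?_).trans
    (Finset.sum_le_sum_of_subset_of_nonneg (Finset.filter_subset _ _) fun _ _ _ => sq_nonneg _)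
  rw [← sq_abs (∫ x, g x * χ a x ∂D)]
  exact pow_le_pow_left₀ hτ.le (Finset.mem_filter.1 ha).2 2

/-- Hypotheses of small error correlate with the target. -/
lemma le_integral_of_classError_le {h f : Cube d → ZMod 2} {ε : ℝ}
    (he : classError D h f ≤ ε) : 1 - 2 * ε ≤ ∫ x, bitSign (h x) * bitSign (f x) ∂D := by
  have h2 : ∀ x, bitSign (h x) * bitSign (f x) =
      1 - 2 * Set.indicator {x | h x ≠ f x} 1 x := by
    intro x
    by_cases hx : h x = f x
    · simp [hx, bitSign_mul_self]
    · have h' : ∀ a b : ZMod 2, a ≠ b → (a = 0 ∧ b ≠ 0) ∨ (a ≠ 0 ∧ b = 0) := by decide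
      rw [Set.indicator_of_mem (show x ∈ {x | h x ≠ f x} from hx)]
      rcases h' _ _ hx with ⟨h1, h2⟩ | ⟨h1, h2⟩ <;> simp [bitSign, h1, h2] <;> norm_num
  simp_rw [h2]
  rw [integral_sub (integrable_cube D _) (integrable_cube D _), integral_const_mul,
    integral_indicator_one MeasurableSet.of_discrete]
  unfold classError at he
  simp
  linarith

/-- The mean of a query with respect to a uniformly random label. -/
noncomputable def blindMean (φ : SQuery d) : ℝ := ∫ x, (φ.1 (x, 0) + φ.1 (x, 1)) / 2 ∂D

/-- The part of a query that depends on the label. -/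
noncomputable def labelPart (φ : SQuery d) (x : Cube d) : ℝ := (φ.1 (x, 0) - φ.1 (x, 1)) / 2

lemma abs_labelPart_le (φ : SQuery d) (x : Cube d) : |labelPart φ x| ≤ 1 := by
  have h0 := abs_le.1 (φ.2 (x, 0))
  have h1 := abs_le.1 (φ.2 (x, 1))
  unfold labelPart
  rw [abs_le]
  constructor <;> linarith

/-- The target enters only through its correlation with the label-dependent part of the query. -/
lemma integral_labelled (f : Cube d → ZMod 2) (φ : SQuery d) :
    ∫ e, φ.1 e ∂(labelled D f) =
      blindMean D φ + ∫ x, labelPart φ x * bitSign (f x) ∂D := by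
  rw [labelled, integral_map Measurable.of_discrete.aemeasurable
    Measurable.of_discrete.aestronglyMeasurable, blindMean,
    ← integral_add (integrable_cube D _) (integrable_cube D _)]
  refine integral_congr_ae (ae_of_all _ fun x => ?_)
  have h' : ∀ a : ZMod 2, a = 0 ∨ a = 1 := by decide
  rcases h' (f x) with h | h <;> simp [h, labelPart, bitSign] <;> ring

open Classical in
/-- The oracle that answers by the mean over a random label whenever its tolerance allows it. -/
noncomputable def blindOracle (f : Cube d → ZMod 2) (τ : ℝ) (φ : SQuery d) : ℝ :=
  if |∫ x, labelPart φ x * bitSign (f x) ∂D| ≤ τ then blindMean D φ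
  else ∫ e, φ.1 e ∂(labelled D f)

lemma isSQOracle_blindOracle (f : Cube d → ZMod 2) {τ : ℝ} (hτ : 0 ≤ τ) :
    IsSQOracle D f τ (blindOracle D f τ) := by
  intro φ
  unfold blindOracle
  split_ifs with h
  · rw [integral_labelled D f φ, sub_add_cancel_left, abs_neg]
    exact h
  · simpa using hτ

/-- Agreement is needed only on the queries asked in the run with `O'`, which in the application
does not depend on the target. -/
lemma SQAlgorithm.answers_congr (A : SQAlgorithm d) (O O' : SQuery d → ℝ) (q : ℕ)
    (h : ∀ j < q, O (A.query (A.answers O' j)) = O' (A.query (A.answers O' j))) :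
    A.answers O q = A.answers O' q := by
  induction q with
  | zero => rfl
  | succ q ih =>
    rw [SQAlgorithm.answers, SQAlgorithm.answers, ih fun j hj => h j (by omega), h q (by omega)]

open Classical in
/-- A deterministic statistical query algorithm finds few targets of an orthonormal family. -/
lemma card_learned_le {ι : Type*} [DecidableEq ι] (F : Finset ι) (c : ι → Cube d → ZMod 2)
    (hc : ∀ a ∈ F, ∀ b ∈ F, ∫ x, bitSign (c a x) * bitSign (c b x) ∂D = if a = b then 1 else 0)
    (A : SQAlgorithm d) (q : ℕ) {τ ε : ℝ} (hτ : 0 < τ) (hε : ε < 1 / 2) :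
    ((F.filter fun a => classError D (A.hypothesis (blindOracle D (c a) τ) q) (c a) ≤ ε).card : ℝ)
      ≤ q / τ ^ 2 + 1 / (1 - 2 * ε) ^ 2 := by
  set φ : ℕ → SQuery d := fun j => A.query (A.answers (blindMean D) j)
  set h : Cube d → ZMod 2 := A.hypothesis (blindMean D) q
  -- A learned target correlates with one of the fixed queries `φ j`, or else the oracle stays
  -- blind, the output is the fixed `h`, and the target correlates with `h`.
  have hsub : (F.filter fun a =>
        classError D (A.hypothesis (blindOracle D (c a) τ) q) (c a) ≤ ε) ⊆
      ((Finset.range q).biUnion fun j =>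
        F.filter fun a => τ ≤ |∫ x, labelPart (φ j) x * bitSign (c a x) ∂D|) ∪
      F.filter fun a => 1 - 2 * ε ≤ |∫ x, bitSign (h x) * bitSign (c a x) ∂D| := by
    intro a ha
    obtain ⟨haF, ha⟩ := Finset.mem_filter.1 ha
    by_cases hj : ∃ j < q, τ < |∫ x, labelPart (φ j) x * bitSign (c a x) ∂D|
    · obtain ⟨j, hjq, hj⟩ := hj
      exact Finset.mem_union_left _ (Finset.mem_biUnion.2
        ⟨j, Finset.mem_range.2 hjq, Finset.mem_filter.2 ⟨haF, hj.le⟩⟩)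
    · push Not at hj
      refine Finset.mem_union_right _ (Finset.mem_filter.2 ⟨haF, ?_⟩)
      rw [SQAlgorithm.hypothesis, A.answers_congr _ (blindMean D) q fun j hjq => by
        rw [blindOracle, if_pos (hj j hjq)]] at ha
      exact (le_integral_of_classError_le D ha).trans (le_abs_self _)
  have h1 : ∀ j ∈ Finset.range q,
      ((F.filter fun a => τ ≤ |∫ x, labelPart (φ j) x * bitSign (c a x) ∂D|).card : ℝ) ≤
        1 / τ ^ 2 :=
    fun j _ => card_filter_integral_le D F (fun a x => bitSign (c a x)) hc _
      (abs_labelPart_le (φ j)) hτ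
  have h2 : ((F.filter fun a =>
      1 - 2 * ε ≤ |∫ x, bitSign (h x) * bitSign (c a x) ∂D|).card : ℝ) ≤ 1 / (1 - 2 * ε) ^ 2 :=
    card_filter_integral_le D F (fun a x => bitSign (c a x)) hc _
      (fun x => (abs_bitSign _).le) (by linarith)
  have h3 := (Finset.card_le_card hsub).trans
    ((Finset.card_union_le _ _).trans (Nat.add_le_add_right Finset.card_biUnion_le _))
  calc _ ≤ ((∑ j ∈ Finset.range q,
        (F.filter fun a => τ ≤ |∫ x, labelPart (φ j) x * bitSign (c a x) ∂D|).card +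
        (F.filter fun a =>
          1 - 2 * ε ≤ |∫ x, bitSign (h x) * bitSign (c a x) ∂D|).card : ℕ) : ℝ) := by
        exact_mod_cast h3
    _ ≤ _ := by
        push_cast
        refine add_le_add ((Finset.sum_le_card_nsmul _ _ _ h1).trans ?_) h2
        rw [Finset.card_range, nsmul_eq_mul, mul_one_div]

/-- Learning an orthonormal family by statistical queries takes many queries. -/
lemma card_le_of_sqLearnable {ι : Type*} [DecidableEq ι] (F : Finset ι) (c : ι → Cube d → ZMod 2)
    (hc : ∀ a ∈ F, ∀ b ∈ F, ∫ x, bitSign (c a x) * bitSign (c b x) ∂D = if a = b then 1 else 0)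
    {C : Set (Cube d → ZMod 2)} (hC : ∀ a ∈ F, c a ∈ C) {q : ℕ} {τ ε : ℝ} (hτ : 0 < τ)
    (hε : ε < 1 / 2) (hL : SQLearnable C D q τ ε) :
    2 / 3 * (F.card : ℝ) ≤ q / τ ^ 2 + 1 / (1 - 2 * ε) ^ 2 := by
  classical
  obtain ⟨Ω, _, μ, _, A, hA⟩ := hL
  choose! E hEm hE hEerr using fun a (ha : a ∈ F) =>
    hA (c a) (hC a ha) (blindOracle D (c a) τ) (isSQOracle_blindOracle D (c a) hτ.le)
  have hint : ∀ a ∈ F, Integrable (Set.indicator (E a) (1 : Ω → ℝ)) μ := fun a ha =>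
    (integrable_const (1 : ℝ)).indicator (hEm a ha)
  -- The expected number of learned targets is bounded below by the success probabilities, and above
  -- by `card_learned_le` for each `ω`.
  have h1 : 2 / 3 * (F.card : ℝ) ≤ ∫ ω, ∑ a ∈ F, Set.indicator (E a) (1 : Ω → ℝ) ω ∂μ := by
    rw [integral_finsetSum _ hint, mul_comm, ← nsmul_eq_mul]
    refine Finset.card_nsmul_le_sum _ _ _ fun a ha => ?_
    rw [integral_indicator_one (hEm a ha)]
    exact hE a ha
  refine h1.trans ((integral_mono (integrable_finsetSum _ hint)
    (integrable_const (q / τ ^ 2 + 1 / (1 - 2 * ε) ^ 2)) fun ω => ?_).trans (by simp))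
  refine le_trans ?_ (card_learned_le D F c hc (A ω) q hτ hε)
  rw [Finset.card_filter]
  push_cast
  refine Finset.sum_le_sum fun a ha => ?_
  by_cases hω : ω ∈ E a
  · simp [hω, hEerr a ha ω hω]
  · simp only [hω, not_false_eq_true, Set.indicator_of_notMem]
    split_ifs <;> norm_num

end Cube

/-- Parities of fair coordinates are orthonormal. -/
lemma integral_bitSign_mul {d : ℕ} (θ : unitInterval) (T T' : Finset (Fin d)) :
    ∫ x, bitSign (affParity (T.map (Fin.succEmb d)) 0 x) *
        bitSign (affParity (T'.map (Fin.succEmb d)) 0 x) ∂(prodDist (biasedCoords (d + 1) θ)) =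
      if T = T' then 1 else 0 := by
  classical
  split_ifs with h
  · subst h
    simp [bitSign_mul_self]
  · set D := prodDist (biasedCoords (d + 1) θ)
    set u : Fin (d + 1) → ZMod 2 := fun j =>
      (if j ∈ T.map (Fin.succEmb d) then 1 else 0) + if j ∈ T'.map (Fin.succEmb d) then 1 else 0
    have hg : ∀ x : Cube (d + 1), bitSign (affParity (T.map (Fin.succEmb d)) 0 x) *
        bitSign (affParity (T'.map (Fin.succEmb d)) 0 x) = bitSign (∑ j, u j * bit (x j)) := by
      intro x
      rw [← bitSign_add, affParity_eq_sum, affParity_eq_sum, zero_add, zero_add,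
        ← Finset.sum_add_distrib]
      simp only [u, add_mul]
    -- A fair bit in the symmetric difference; flipping it negates the integrand, so the integral is
    -- `0`.
    obtain ⟨j, hj⟩ : ∃ j : Fin d, u j.succ = 1 := by
      by_contra hcon
      push Not at hcon
      apply h
      ext j
      have := hcon j
      by_cases h1 : j ∈ T <;> by_cases h2 : j ∈ T' <;> simp_all [u]
    have hmp : MeasurePreserving (flipCoord j.succ) D D :=
      measurePreserving_flipCoord (by simp [biasedCoords])
    have h1 : ∫ x, bitSign (∑ i, u i * bit (flipCoord j.succ x i)) ∂D =
        ∫ x, bitSign (∑ i, u i * bit (x i)) ∂D := by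
      conv_rhs => rw [← hmp.map_eq]
      rw [integral_map Measurable.of_discrete.aemeasurable
        Measurable.of_discrete.aestronglyMeasurable]
    simp_rw [sum_flipCoord u hj, bitSign_add] at h1
    rw [integral_mul_const] at h1
    simp_rw [hg]
    have : bitSign 1 = -1 := by simp [bitSign]
    rw [this] at h1
    linarith

/-- Parities are hard to learn by statistical queries if all coordinates but one are fair. -/
lemma sqHard_parityClass (θ : ℕ → unitInterval) :
    SQHard parityClass fun d => prodDist (biasedCoords d (θ d)) := by
  intro ε _ hε a m
  have h1 := tendsto_pow_const_div_const_pow_of_one_lt (m + 2 * a) (one_lt_two (α := ℝ))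
  have h2 := tendsto_pow_const_div_const_pow_of_one_lt 0 (one_lt_two (α := ℝ))
  have h3 := h2.const_mul (1 / (1 - 2 * ε) ^ 2)
  rw [mul_zero] at h3
  -- The family has `2 ^ d` members in dimension `d + 1`. Both terms of the bound become less than
  -- `2 ^ (d + 1) / 12`, in total less than `2 ^ d / 3`, against `2 / 3 * 2 ^ d`.
  filter_upwards [h1.eventually_lt_const (show (0 : ℝ) < 1 / 12 by norm_num),
    h3.eventually_lt_const (show (0 : ℝ) < 1 / 12 by norm_num), eventually_ge_atTop 1]
    with d hd1 hd2 hd q τ hq hτ hL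
  obtain ⟨d, rfl⟩ := Nat.exists_eq_add_of_le' hd
  have hτ0 : 0 < τ := lt_of_lt_of_le (by positivity) hτ
  have key := card_le_of_sqLearnable _ (Finset.univ : Finset (Finset (Fin d)))
    (fun T => affParity (T.map (Fin.succEmb d)) 0)
    (fun T _ T' _ => integral_bitSign_mul (θ (d + 1)) T T')
    (C := parityClass (d + 1)) (fun T _ => ⟨T.map (Fin.succEmb d), rfl⟩) hτ0 hε hL
  rw [Finset.card_univ, Fintype.card_finset, Fintype.card_fin] at key
  have hq' : (q : ℝ) / τ ^ 2 ≤ ((d + 1 : ℕ) : ℝ) ^ (m + 2 * a) := by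
    have hdpos : (0 : ℝ) < ((d + 1 : ℕ) : ℝ) ^ a := by positivity
    have h1 : 1 ≤ τ * ((d + 1 : ℕ) : ℝ) ^ a := by
      rwa [div_le_iff₀ hdpos] at hτ
    have h2 : (1 : ℝ) ≤ τ ^ 2 * ((d + 1 : ℕ) : ℝ) ^ (2 * a) := by
      have := one_le_pow₀ h1 (n := 2)
      rwa [mul_pow, ← pow_mul, mul_comm a] at this
    rw [div_le_iff₀ (by positivity), pow_add]
    have h3 : (q : ℝ) ≤ ((d + 1 : ℕ) : ℝ) ^ m := by exact_mod_cast hq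
    calc (q : ℝ) ≤ ((d + 1 : ℕ) : ℝ) ^ m * 1 := by rw [mul_one]; exact h3
      _ ≤ ((d + 1 : ℕ) : ℝ) ^ m * (τ ^ 2 * ((d + 1 : ℕ) : ℝ) ^ (2 * a)) := by gcongr
      _ = _ := by ring
  have h2d : (0 : ℝ) < 2 ^ (d + 1) := by positivity
  rw [div_lt_iff₀ h2d] at hd1
  rw [pow_zero, mul_one_div, div_lt_iff₀ h2d] at hd2
  push_cast at key hd1 hq'
  rw [pow_succ (2 : ℝ) d] at hd1 hd2 h2d
  linarith

/-! ### The choice of the parameters -/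

/-- The probability `1 - 1 / n` of the first coordinate. -/
noncomputable def firstProb (n : ℕ) : unitInterval :=
  ⟨1 - 1 / n, by rw [one_div]; linarith [Nat.cast_inv_le_one (α := ℝ) n],
    by rw [one_div, sub_le_self_iff]; positivity⟩

/-- The sample size. -/
noncomputable def sampleSize (d : ℕ) (α β ρ : ℝ) : ℕ :=
  ⌈4 * (d : ℝ) + 8 * (1 / ρ) + 4 * Real.log (1 / β) + 1 / α + 32⌉₊

/-- The law of the samples used for elimination. -/
noncomputable abbrev hardDist (d n : ℕ) : Measure (Cube d) := prodDist (biasedCoords d (firstProb n))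

section Estimates

variable {n : ℕ}

lemma half_le_firstProb (hn : 2 ≤ n) : (1 / 2 : ℝ) ≤ firstProb n := by
  have h : (2 : ℝ) ≤ n := by exact_mod_cast hn
  have := one_div_le_one_div_of_le two_pos h
  simp only [firstProb]
  linarith

lemma firstProb_pow_le (hn : 2 ≤ n) : (firstProb n : ℝ) ^ n ≤ 1 / 2 := by
  have h : (1 : ℝ) ≤ n := by exact_mod_cast (by omega : 1 ≤ n)
  refine (Real.one_sub_div_pow_le_exp_neg h).trans ?_
  rw [Real.exp_neg, one_div]
  exact inv_anti₀ two_pos (by linarith [Real.add_one_le_exp (1 : ℝ)])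

/-- From `1 - 1/n ≥ exp (-1/(n-1))` the power is at least `exp (-n/(n-1)) ≥ exp (-2)`, and `e < 3`.
-/
lemma le_firstProb_pow (hn : 2 ≤ n) : 1 / 9 ≤ (firstProb n : ℝ) ^ n := by
  have h : (2 : ℝ) ≤ n := by exact_mod_cast hn
  have h1 : (0 : ℝ) < n - 1 := by linarith
  have h2 : Real.exp (-(1 / (n - 1))) ≤ (firstProb n : ℝ) := by
    rw [Real.exp_neg]
    have := Real.add_one_le_exp (1 / ((n : ℝ) - 1))
    have h3 : (firstProb n : ℝ) = (1 / ((n : ℝ) - 1) + 1)⁻¹ := by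
      simp only [firstProb]
      field_simp
      ring
    rw [h3]
    exact inv_anti₀ (by positivity) this
  refine le_trans ?_ (pow_le_pow_left₀ (Real.exp_nonneg _) h2 n)
  rw [← Real.exp_nat_mul, mul_neg, Real.exp_neg, one_div]
  refine inv_anti₀ (Real.exp_pos _) ?_
  have h4 : (n : ℝ) * (1 / (n - 1)) ≤ 1 + 1 := by
    rw [mul_one_div, div_le_iff₀ h1]
    linarith
  refine (Real.exp_le_exp.2 h4).trans ?_
  rw [Real.exp_add]
  nlinarith [Real.exp_one_lt_three, Real.exp_pos 1]

end Estimates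

section SampleSize

variable {d : ℕ} {α β ρ : ℝ}

lemma sampleSize_bounds (hα : α ∈ Set.Ioo (0 : ℝ) 1) (hβ : β ∈ Set.Ioo (0 : ℝ) 1)
    (hρ : ρ ∈ Set.Ioo (0 : ℝ) 1) :
    0 < 1 / α ∧ 0 < Real.log (1 / β) ∧ 0 < 1 / ρ ∧
    4 * (d : ℝ) + 8 * (1 / ρ) + 4 * Real.log (1 / β) + 1 / α + 32 ≤ sampleSize d α β ρ := by
  refine ⟨one_div_pos.2 hα.1, Real.log_pos ?_, one_div_pos.2 hρ.1, Nat.le_ceil _⟩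
  rw [lt_one_div one_pos hβ.1, one_div_one]
  exact hβ.2

lemma le_sampleSize (hα : α ∈ Set.Ioo (0 : ℝ) 1) (hβ : β ∈ Set.Ioo (0 : ℝ) 1)
    (hρ : ρ ∈ Set.Ioo (0 : ℝ) 1) :
    d ≤ sampleSize d α β ρ ∧ 2 ≤ sampleSize d α β ρ ∧
    1 / (sampleSize d α β ρ : ℝ) ≤ α := by
  obtain ⟨h1, h2, h3, h4⟩ := sampleSize_bounds (d := d) hα hβ hρ
  have hd : (0 : ℝ) ≤ d := Nat.cast_nonneg d
  refine ⟨?_, ?_, ?_⟩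
  · have : (d : ℝ) ≤ sampleSize d α β ρ := by linarith
    exact_mod_cast this
  · have : (2 : ℝ) ≤ sampleSize d α β ρ := by linarith
    exact_mod_cast this
  · rw [one_div_le (by linarith) hα.1]
    linarith

/-- Since `(3/4) ^ n ≤ exp (-n/4)`, the summand `4 * d` of the sample size beats `2 ^ d`; the
summands with `ρ`, with `β` and the constant `32` yield the three bounds in turn. -/
lemma failure_le (hα : α ∈ Set.Ioo (0 : ℝ) 1) (hβ : β ∈ Set.Ioo (0 : ℝ) 1)
    (hρ : ρ ∈ Set.Ioo (0 : ℝ) 1) :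
    (2 : ℝ) ^ d * (3 / 4) ^ sampleSize d α β ρ ≤ ρ / 2 ∧
    (2 : ℝ) ^ d * (3 / 4) ^ sampleSize d α β ρ ≤ β ∧
    (2 : ℝ) ^ d * (3 / 4) ^ sampleSize d α β ρ ≤ 1 / 8 := by
  obtain ⟨h1, h2, h3, h4⟩ := sampleSize_bounds (d := d) hα hβ hρ
  set n := sampleSize d α β ρ
  have hbase : (2 : ℝ) ^ d * (3 / 4) ^ n ≤
      Real.exp (-(2 * (1 / ρ) + Real.log (1 / β) + 8)) := by
    have ha : (2 : ℝ) ^ d ≤ Real.exp d := by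
      rw [← mul_one (d : ℝ), Real.exp_nat_mul]
      exact pow_le_pow_left₀ two_pos.le (by linarith [Real.add_one_le_exp (1 : ℝ)]) d
    have hb : (3 / 4 : ℝ) ^ n ≤ Real.exp (n * (-1 / 4)) := by
      rw [Real.exp_nat_mul]
      exact pow_le_pow_left₀ (by norm_num) (by linarith [Real.add_one_le_exp (-1 / 4 : ℝ)]) n
    refine (mul_le_mul ha hb (by positivity) (Real.exp_nonneg _)).trans ?_
    rw [← Real.exp_add, Real.exp_le_exp]
    linarith
  refine ⟨hbase.trans ?_, hbase.trans ?_, hbase.trans ?_⟩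
  · refine (Real.exp_le_exp.2 (show _ ≤ -(2 * (1 / ρ)) by linarith)).trans ?_
    rw [Real.exp_neg]
    have := Real.add_one_le_exp (2 * (1 / ρ))
    rw [inv_le_comm₀ (Real.exp_pos _) (by linarith [hρ.1]), inv_div, ← mul_one_div]
    linarith
  · refine (Real.exp_le_exp.2 (show _ ≤ -Real.log (1 / β) by linarith)).trans ?_
    rw [one_div, Real.log_inv, neg_neg, Real.exp_log hβ.1]
  · refine (Real.exp_le_exp.2 (show _ ≤ -8 by linarith)).trans ?_
    rw [Real.exp_neg, one_div]
    exact inv_anti₀ (by norm_num) (by linarith [Real.add_one_le_exp (8 : ℝ)])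

lemma sampleSize_le (hα : α ∈ Set.Ioo (0 : ℝ) 1) (hβ : β ∈ Set.Ioo (0 : ℝ) 1)
    (hρ : ρ ∈ Set.Ioo (0 : ℝ) 1) :
    (sampleSize d α β ρ : ℝ) ≤
    4 * (d : ℝ) + 8 * (1 / ρ) + 4 * Real.log (1 / β) + 1 / α + 33 := by
  obtain ⟨h1, h2, h3, -⟩ := sampleSize_bounds (d := d) hα hβ hρ
  have := Nat.ceil_lt_add_one
    (show 0 ≤ 4 * (d : ℝ) + 8 * (1 / ρ) + 4 * Real.log (1 / β) + 1 / α + 32 by positivity)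
  unfold sampleSize
  linarith

end SampleSize

/-! ### Gaussian elimination is not replicable -/

section Failure

variable {d n : ℕ}

/-- The samples in which the first bit is always `1`. -/
def constFirst (d n : ℕ) : Set (Fin n → Cube (d + 1)) := {s | ∀ i, s i ∈ {x | x 0 = true}}

lemma real_constFirst : (iidLaw (hardDist (d + 1) n) n).real (constFirst d n) =
    (firstProb n : ℝ) ^ n := by
  rw [constFirst, real_iidLaw_forall, real_first_coord]
  simp [biasedCoords]

/-- The sample fails to determine with probability at most `1/8` and has constant first bit with
probability at most `1/2`. -/
lemma le_real_unique (hn : 2 ≤ n) (hfail : (2 : ℝ) ^ (d + 1) * (3 / 4) ^ n ≤ 1 / 8) :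
    3 / 8 ≤ (iidLaw (hardDist (d + 1) n) n).real {s | Determines s ∧ ∃ i, s i 0 = false} := by
  have hcov : Set.univ ⊆ {s : Fin n → Cube (d + 1) | Determines s ∧ ∃ i, s i 0 = false} ∪
      ({s | ¬ Determines s} ∪ constFirst d n) := by
    intro s _
    by_cases h1 : Determines s
    · by_cases h2 : ∃ i, s i 0 = false
      · exact Or.inl ⟨h1, h2⟩
      · exact Or.inr (Or.inr fun i => by simpa using not_exists.1 h2 i)
    · exact Or.inr (Or.inl h1)
  have h := (measureReal_mono (μ := iidLaw (hardDist (d + 1) n) n) hcov).trans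
    ((measureReal_union_le _ _).trans (add_le_add_right (measureReal_union_le _ _) _))
  rw [probReal_univ, real_constFirst] at h
  have := real_not_determines_le (d := d) (half_le_firstProb hn) n
  linarith [firstProb_pow_le hn]

lemma exists_le_disagreement_gaussLearner (hn : 2 ≤ n)
    (hfail : (2 : ℝ) ^ (d + 1) * (3 / 4) ^ n ≤ 1 / 8) {k : ℕ} (R : Measure (Fin k → Bool))
    [IsProbabilityMeasure R]
    (tie : (Fin n → Example (d + 1)) → (Fin k → Bool) → (Fin (d + 2) → ZMod 2)) :
    ∃ f ∈ affParityClass (d + 1),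
      1 / 48 ≤ disagreement (labelled (hardDist (d + 1) n) f) R (gaussLearner tie) := by
  set ν := iidLaw (hardDist (d + 1) n) n
  set W : (Cube (d + 1) → ZMod 2) → Set ((Fin n → Cube (d + 1)) × (Fin k → Bool)) :=
    fun f => {t | gaussLearner tie (fun i => (t.1 i, f (t.1 i))) t.2 ≠ f}
  have hdis : ∀ S b, 3 / 8 * (ν.prod R).real (W (affParity S b)) ≤
      disagreement (labelled (hardDist (d + 1) n) (affParity S b)) R (gaussLearner tie) := by
    intro S b
    refine le_trans ?_ (mul_le_disagreement _ (affParity S b) R (gaussLearner tie)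
      {s | Determines s ∧ ∃ i, s i 0 = false} (W (affParity S b)) ?_)
    · exact mul_le_mul_of_nonneg_right (le_real_unique hn hfail) measureReal_nonneg
    · intro s hs t ht
      rw [gaussLearner_eq tie S b hs.1 hs.2 t.2]
      exact fun h => ht h.symm
  -- The targets `0` and `1 + x₀` label these samples alike but differ at the zero vector, so one
  -- output cannot be right for both.
  have hcov : constFirst d n ×ˢ Set.univ ⊆ W (affParity ∅ 0) ∪ W (affParity {0} 1) := by
    rintro ⟨s, r⟩ ⟨hs, -⟩
    have hsame : (fun i => (s i, affParity ∅ 0 (s i))) =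
        fun i => (s i, affParity ({0} : Finset (Fin (d + 1))) 1 (s i)) := by
      funext i
      have h2 : (1 : ZMod 2) + 1 = 0 := rfl
      have h0 : s i 0 = true := hs i
      rw [affParity, affParity, Finset.sum_empty, Finset.sum_singleton, h0]
      exact Prod.ext rfl h2.symm
    by_contra hc
    simp only [Set.mem_union, not_or] at hc
    have h0 : gaussLearner tie (fun i => (s i, affParity ∅ 0 (s i))) r = affParity ∅ 0 :=
      not_not.1 hc.1
    have h1 : gaussLearner tie (fun i => (s i, affParity {0} 1 (s i))) r = affParity {0} 1 :=
      not_not.1 hc.2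
    rw [← hsame, h0] at h1
    have := congrFun h1 fun _ => false
    simp [affParity, bit] at this
  have h := (measureReal_mono (μ := ν.prod R) hcov).trans (measureReal_union_le _ _)
  rw [measureReal_prod_prod, probReal_univ, mul_one, real_constFirst] at h
  have hK := le_firstProb_pow hn
  -- One of the two events has at least half of the mass `1/9`, and `3/8 * 1/18 = 1/48`.
  rcases le_total (1 / 18) ((ν.prod R).real (W (affParity ∅ 0))) with h0 | h0
  · exact ⟨_, ⟨∅, 0, rfl⟩, by linarith [hdis ∅ 0]⟩
  · exact ⟨_, ⟨{0}, 1, rfl⟩, by linarith [hdis {0} 1]⟩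

/-- The factors are `3/8` for a run that finds the target, `1/9` for a constant first bit in the
other run, and `1/2` for a wrong random bias. -/
lemma le_disagreement_gaussLearner_uniform (hn : 2 ≤ n)
    (hfail : (2 : ℝ) ^ (d + 1) * (3 / 4) ^ n ≤ 1 / 8) {f : Cube (d + 1) → ZMod 2}
    (hf : f ∈ affParityClass (d + 1)) :
    1 / 48 ≤ disagreement (n := n) (labelled (hardDist (d + 1) n) f) (uniformBits (d + 2))
      (gaussLearner fun _ r i => bit (r i)) := by
  obtain ⟨S, b, rfl⟩ := hf
  have h := mul_le_disagreement (hardDist (d + 1) n) (affParity S b) (uniformBits (d + 2))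
    (gaussLearner fun (_ : Fin n → Example (d + 1)) r i => bit (r i))
    {s | Determines s ∧ ∃ i, s i 0 = false}
    (constFirst d n ×ˢ {r | bit (r (Fin.last _)) ≠ b}) (by
      rintro s hs ⟨s', r⟩ ⟨hs', hr⟩
      rw [gaussLearner_eq _ S b hs.1 hs.2]
      intro h
      have := congrFun h fun _ => false
      rw [gaussLearner_zero _ (fun i => (s' i, affParity S b (s' i))) fun i => hs' i] at this
      exact hr (by simpa [affParity, bit] using this.symm))
  rw [measureReal_prod_prod, real_uniformBits_ne, real_constFirst] at h
  nlinarith [le_real_unique hn hfail, le_firstProb_pow hn]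

end Failure

/-! ### The elimination learner is replicable and accurate -/

section Success

variable {d n k : ℕ}

lemma isReplicable_elimLearner (hn : 2 ≤ n) {ρ : ℝ}
    (hfail : (2 : ℝ) ^ (d + 1) * (3 / 4) ^ n ≤ ρ / 2) {f : Cube (d + 1) → ZMod 2}
    (hf : f ∈ affParityClass (d + 1)) :
    IsReplicable (labelled (hardDist (d + 1) n) f) (uniformBits k)
      (elimLearner : (Fin n → Example (d + 1)) → (Fin k → Bool) → _) ρ := by
  obtain ⟨S, b, rfl⟩ := hf
  refine (disagreement_le _ (affParity S b) (uniformBits k) elimLearner {s | Determines s}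
    fun s hs s' hs' r => elimLearner_eq S b s s' hs hs' r).trans ?_
  have := real_not_determines_le (d := d) (half_le_firstProb hn) n
  change 2 * (iidLaw (hardDist (d + 1) n) n).real {s | ¬ Determines s} ≤ ρ
  linarith

lemma isPACLearner_elimLearner (hn : 2 ≤ n) {α β : ℝ} (hα : 1 / (n : ℝ) ≤ α)
    (hfail : (2 : ℝ) ^ (d + 1) * (3 / 4) ^ n ≤ β) :
    IsPACLearner (affParityClass (d + 1)) (hardDist (d + 1) n) (uniformBits k)
      (fun (s : Fin n → Example (d + 1)) r => affParity (elimLearner s r).1 (elimLearner s r).2)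
      α β := by
  rintro f ⟨S, b, rfl⟩
  refine le_trans ?_ (le_real_prod_labelled _ (affParity S b) (uniformBits k) {s | Determines s}
    _ fun s hs r => ?_)
  · have := real_not_determines_le (d := d) (half_le_firstProb hn) n
    have hc := probReal_compl_eq_one_sub (μ := iidLaw (hardDist (d + 1) n) n)
      (s := {s | Determines s}) MeasurableSet.of_discrete
    change (iidLaw (hardDist (d + 1) n) n).real {s | ¬ Determines s} = _ at hc
    linarith
  -- All errors lie in the discarded half cube `x₀ = 0`, of mass `1/n`.
  · have hsub : {x : Cube (d + 1) | affParity (elimLearner (fun i => (s i, affParity S b (s i))) r).1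
        (elimLearner (fun i => (s i, affParity S b (s i))) r).2 x ≠ affParity S b x} ⊆
        {x | x 0 = true}ᶜ := fun x hx h => hx (affParity_elimLearner S b s hs r h)
    refine (measureReal_mono hsub).trans ?_
    rw [probReal_compl_eq_one_sub MeasurableSet.of_discrete, real_first_coord]
    simpa [biasedCoords, firstProb] using hα

end Success

theorem theoremC2 :
    ∃ (N : MvPolynomial (Fin 4) ℝ) (c : ℝ)
      (M : Turing.TM2ComputableAux (Option (ZMod 2)) (ZMod 2)) (T κ : Polynomial ℕ)
      (n : ℕ → ℝ → ℝ → ℝ → ℕ) (p : (d : ℕ) → ℝ → ℝ → ℝ → Fin d → unitInterval),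
      0 < c ∧
      (∀ (d : ℕ) (α β ρ : ℝ), 1 ≤ d → α ∈ Set.Ioo (0 : ℝ) 1 → β ∈ Set.Ioo (0 : ℝ) 1 →
        ρ ∈ Set.Ioo (0 : ℝ) 1 →
        (n d α β ρ : ℝ) ≤ MvPolynomial.eval ![(d : ℝ), 1 / α, 1 / ρ, Real.log (1 / β)] N ∧
        IsMonotoneDist (prodDist (p d α β ρ)) ∧
        -- Gaussian elimination fails, for every tie-breaking rule and every law of random strings
        (∀ (k : ℕ) (R : Measure (Fin k → Bool)), IsProbabilityMeasure R →
          ∀ tie : (Fin (n d α β ρ) → Example d) → (Fin k → Bool) → (Fin (d + 1) → ZMod 2),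
          ∃ f ∈ affParityClass d,
            c ≤ disagreement (labelled (prodDist (p d α β ρ)) f) R (gaussLearner tie)) ∧
        -- Gaussian elimination fails for every target, with uniformly random values for the free unknowns
        (∀ f ∈ affParityClass d,
          c ≤ disagreement (n := n d α β ρ) (labelled (prodDist (p d α β ρ)) f)
            (uniformBits (d + 1)) (gaussLearner fun _ r i => bit (r i))) ∧
        -- an efficient replicable PAC learner for affine parities
        (∃ A : (Fin (n d α β ρ) → Example d) → (Fin (κ.eval (n d α β ρ)) → Bool) →
            Finset (Fin d) × ZMod 2,
          ComputesInTime M A (T.eval (n d α β ρ)) ∧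
          (∀ f ∈ affParityClass d,
            IsReplicable (labelled (prodDist (p d α β ρ)) f) (uniformBits _) A ρ) ∧
          IsPACLearner (affParityClass d) (prodDist (p d α β ρ)) (uniformBits _)
            (fun s r => affParity (A s r).1 (A s r).2) α β)) ∧
      -- learning parities is SQ-hard
      (∀ α β ρ : ℕ → ℝ, (∀ d, α d ∈ Set.Ioo (0 : ℝ) 1) → (∀ d, β d ∈ Set.Ioo (0 : ℝ) 1) →
        (∀ d, ρ d ∈ Set.Ioo (0 : ℝ) 1) →
        SQHard parityClass fun d => prodDist (p d (α d) (β d) (ρ d))) := by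
  refine ⟨4 * MvPolynomial.X 0 + 8 * MvPolynomial.X 2 + 4 * MvPolynomial.X 3 + MvPolynomial.X 1 +
      33, 1 / 48, elimComputer,
    -- The time bound of the machine with `d` replaced by `n ≥ d`; the learner is deterministic, so
    -- `κ = 0`.
    (Polynomial.X + 2) * (5 * (Polynomial.X * (Polynomial.X + 2) + 1 + Polynomial.X) + 6), 0,
    sampleSize, fun d α β ρ => biasedCoords d (firstProb (sampleSize d α β ρ)), by norm_num, ?_,
    fun α β ρ _ _ _ => sqHard_parityClass fun d => firstProb (sampleSize d (α d) (β d) (ρ d))⟩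
  intro d α β ρ hd hα hβ hρ
  obtain ⟨d, rfl⟩ := Nat.exists_eq_add_of_le' hd
  obtain ⟨hdn, hn, hnα⟩ := le_sampleSize (d := d + 1) hα hβ hρ
  obtain ⟨hfρ, hfβ, hf8⟩ := failure_le (d := d + 1) hα hβ hρ
  refine ⟨?_, ?_, fun k R _ tie => exists_le_disagreement_gaussLearner hn hf8 R tie,
    fun f hf => le_disagreement_gaussLearner_uniform hn hf8 hf, elimLearner, ?_,
    fun f hf => isReplicable_elimLearner hn hfρ hf, isPACLearner_elimLearner hn hnα hfβ⟩
  · simpa using sampleSize_le (d := d + 1) hα hβ hρ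
  · refine isMonotoneDist_prodDist fun j => ?_
    change _ ≤ (biasedCoords _ _ j : ℝ)
    unfold biasedCoords
    split_ifs
    · exact half_le_firstProb hn
    · exact le_rfl
  · intro s r
    obtain ⟨h⟩ := computesInTime_elimLearner (k := (0 : Polynomial ℕ).eval _)
      Polynomial.eval_zero (by omega) s r
    refine ⟨⟨h.toEvalsTo, h.steps_le_m.trans ?_⟩⟩
    simp only [Polynomial.eval_mul, Polynomial.eval_add, Polynomial.eval_X, Polynomial.eval_ofNat,
      Polynomial.eval_one]
    gcongr
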